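/- Let $1\le n\le d$ and let $P=(P_1,\dots,P_n)$ be real quadratic forms on $\mathbb R^d$. For $\delta\in 2^{-\mathbb N}$ let $\mathcal P(\delta)$ be the set of dyadic subcubes of $[0,1]^d$ of side length $\delta$, and for $\Box=a+\delta[0,1]^d\in\mathcal P(\delta)$ put $$\mathcal U_\Box=\{(a+\delta s,\;P(a)+\delta\, DP(a)s+\delta^2u)\;:\; s\in[-C,C]^d,\ u\in[-C,C]^n\}\subset\mathbb R^{d+n},$$ where $C$ is a fixed large constant. Let $\mathcal H=\{t_d=\mathcal L(t')\}$, $t'=(t_1,\dots,t_{d-1})$, be a hyperplane that intersects $[0,1]^d$, where $\mathcal L(t')=b+v\cdot t'$ is affine with $|\nabla\mathcal L|=|v|\le M$. Let $P'(t')=P(t',\mathcal L(t'))$, and let $\mathrm{Dec}^p_{\mathcal H}(\delta)$ be the smallest constant $D\ge0$ such that $$\Big\|\sum_\theta f_\theta\Big\|_{L^p(\mathbb R^{d-1+n})}\le D\Big(\sum_\theta\|f_\theta\|_{L^p}^p\Big)^{1/p}$$ for all $f_\theta\in L^p(\mathbb R^{d-1+n})$ with $\operatorname{supp}\widehat{f_\theta}\subseteq\mathcal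 U'_\theta$, where $\theta$ runs over the dyadic subcubes of $[0,1]^{d-1}$ of side length $\delta$ and $\mathcal U'_\theta$ is defined as above with $P',\,d-1$ in place of $P,\,d$ (and the same $C$). Here $\widehat f$ is the Fourier transform in the sense of tempered distributions. For all $P$ and $M$ there is $C_0$ such that for every $C\ge C_0$ and every $A$ there is a constant $C_{\mathcal S}$ (depending only on $d,n,P,M,C,A$) such that the following holds. For every $1\le p<\infty$, $\Lambda\in\mathbb R$ and $0<c<\infty$ there is a constant $K$ such that, for every $\mathcal H$ as above with $|\nabla\mathcal L|\le M$ and $$\mathrm{Dec}^p_{\mathcal H}(\delta)\le A\,\delta^{-\Lambda}\qquad\text{for all }\delta\in 2^{-\mathbb N},$$ one has, for every $\delta\in2^{-\mathbb N}$ with $\delta<1$ and all $f_\Box\in L^p(\mathbb R^{d+n})$ with $\operatorname{supp}\widehat{f_\Box}\subseteq\mathcal U_\Box$, $$\Big\|\sum_{\Box\in\mathcal P(\delta),\ c\Box\cap\mathcal H\ne\emptyset}f_\Box\Big\|_{L^p}\le K\,|\log\delta|^{C_{\mathcal S}}\,\delta^{-\Lambda}\Big(\sum_{\Box\in\mathcal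 P(\delta),\ c\Box\cap\mathcal H\ne\emptyset}\|f_\Box\|_{L^p}^p\Big)^{1/p},$$ where $c\Box$ is the dilate of $\Box$ by the factor $c$ about its center. -/

import Mathlib

open MeasureTheory
open scoped FourierTransform ENNReal SchwartzMap

noncomputable section

/-- The ambient space `ℝ^{d+n} = ℝ^d × ℝ^n`, with its Euclidean norm and Lebesgue measure. -/
abbrev DecSpace (d n : ℕ) : Type := EuclideanSpace ℝ (Fin d ⊕ Fin n)

/-- Indices of the dyadic subcubes of `[0,1]^d` of side length `2^{-k}`: the index `j` stands for
the cube `2^{-k} (j + [0,1]^d)`. -/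
abbrev DyadicIndex (d k : ℕ) : Type := Fin d → Fin (2 ^ k)

/-- The dyadic scale `δ = 2^{-k}`. -/
def dyadicScale (k : ℕ) : ℝ := (2 ^ k : ℝ)⁻¹

/-- The lower corner `a` of the dyadic cube `a + δ [0,1]^d`. -/
def dyadicCorner {d k : ℕ} (j : DyadicIndex d k) : Fin d → ℝ :=
  fun i => dyadicScale k * (j i : ℕ)

/-- The dilate `c □` of the dyadic cube `□` with index `j`, about the center of `□`
(so `c = 1` gives the closed cube itself). -/
def dilatedCube {d k : ℕ} (c : ℝ) (j : DyadicIndex d k) : Set (Fin d → ℝ) :=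
  {t | ∀ i, |t i - (dyadicCorner j i + dyadicScale k / 2)| ≤ c * (dyadicScale k / 2)}

/-- The parallelepiped `(a, φ(a)) + L_θ^* ([-C,C]^{d+n})` attached to the graph of
`φ : ℝ^d → ℝ^n` over the dyadic cube `θ = a + δ [0,1]^d`, where
`L_θ^* (s, u) = (δ s, δ Dφ(a) s + δ² u)`. -/
def uncertaintyBox {d n k : ℕ} (C : ℝ) (φ : (Fin d → ℝ) → Fin n → ℝ) (j : DyadicIndex d k) :
    Set (DecSpace d n) :=
  {ξ | ∃ (s : Fin d → ℝ) (u : Fin n → ℝ), (∀ i, |s i| ≤ C) ∧ (∀ l, |u l| ≤ C) ∧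
    (∀ i, ξ (Sum.inl i) = dyadicCorner j i + dyadicScale k * s i) ∧
    (∀ l, ξ (Sum.inr l) = φ (dyadicCorner j) l
      + dyadicScale k * fderiv ℝ φ (dyadicCorner j) s l + dyadicScale k ^ 2 * u l)}

/-- `supp f̂ ⊆ U` for a closed set `U`, where `f ∈ L^p` and `f̂` is the Fourier transform of `f` as a
tempered distribution: `f̂` vanishes on the open set `Uᶜ`. -/
def HasFourierSupportIn {d n : ℕ} {p : ℝ≥0∞} [Fact (1 ≤ p)]
    (f : Lp ℂ p (volume : Measure (DecSpace d n))) (U : Set (DecSpace d n)) : Prop :=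
  Distribution.IsVanishingOn
    (𝓕 (Lp.toTemperedDistribution f) : 𝓢'(DecSpace d n, ℂ)) Uᶜ

/-- The inequality `‖∑_{θ ∈ S} f_θ‖_p ≤ D (∑_{θ ∈ S} ‖f_θ‖_p^p)^{1/p}` for all families of
functions `f_θ ∈ L^p(ℝ^{d+n})` with `supp f̂_θ ⊆ U_θ`, for a collection `S` of dyadic cubes
of side length `2^{-k}`. -/
def DecouplingInequality {d n : ℕ} (p : ℝ≥0∞) [Fact (1 ≤ p)] (C : ℝ)
    (φ : (Fin d → ℝ) → Fin n → ℝ) (k : ℕ) (S : Finset (DyadicIndex d k)) (D : ℝ) : Prop :=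
  ∀ f : DyadicIndex d k → Lp ℂ p (volume : Measure (DecSpace d n)),
    (∀ j ∈ S, HasFourierSupportIn (f j) (uncertaintyBox C φ j)) →
    ‖∑ j ∈ S, f j‖ ≤ D * (∑ j ∈ S, ‖f j‖ ^ p.toReal) ^ (1 / p.toReal)

/-- The decoupling constant `Dec^p(2^{-k})` of the graph of `φ : ℝ^d → ℝ^n`: the smallest constant
in the decoupling inequality for all dyadic cubes of side length `2^{-k}` in `[0,1]^d`. -/
def decouplingConst {d n : ℕ} (p : ℝ≥0∞) [Fact (1 ≤ p)] (C : ℝ)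
    (φ : (Fin d → ℝ) → Fin n → ℝ) (k : ℕ) : ℝ :=
  sInf {D : ℝ | 0 ≤ D ∧ DecouplingInequality p C φ k Finset.univ D}

/-- The infimum defining the decoupling constant is attained. -/
theorem decouplingConst_isLeast {d n : ℕ} (p : ℝ≥0∞) [hp : Fact (1 ≤ p)] (hp' : p ≠ ∞) (C : ℝ)
    (φ : (Fin d → ℝ) → Fin n → ℝ) (k : ℕ) :
    IsLeast {D : ℝ | 0 ≤ D ∧ DecouplingInequality p C φ k Finset.univ D}
      (decouplingConst p C φ k) := by
  have hp0 : 0 < p.toReal := ENNReal.toReal_pos (by have := hp.out; positivity) hp'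
  have hne : {D : ℝ | 0 ≤ D ∧ DecouplingInequality p C φ k Finset.univ D}.Nonempty := by
    refine ⟨(Fintype.card (DyadicIndex d k) : ℝ), by positivity, fun f _ => ?_⟩
    have key : ∀ j, ‖f j‖ ≤ (∑ i, ‖f i‖ ^ p.toReal) ^ (1 / p.toReal) := by
      intro j
      have h1 : ‖f j‖ ^ p.toReal ≤ ∑ i, ‖f i‖ ^ p.toReal :=
        Finset.single_le_sum (f := fun i => ‖f i‖ ^ p.toReal)
          (fun i _ => by positivity) (Finset.mem_univ j)
      calc ‖f j‖ = (‖f j‖ ^ p.toReal) ^ (1 / p.toReal) := by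
            rw [← Real.rpow_mul (norm_nonneg _), mul_one_div_cancel hp0.ne', Real.rpow_one]
        _ ≤ _ := Real.rpow_le_rpow (by positivity) h1 (by positivity)
    calc ‖∑ j, f j‖ ≤ ∑ j, ‖f j‖ := norm_sum_le _ _
      _ ≤ ∑ _j : DyadicIndex d k, (∑ i, ‖f i‖ ^ p.toReal) ^ (1 / p.toReal) :=
          Finset.sum_le_sum fun j _ => key j
      _ = _ := by rw [Finset.sum_const, nsmul_eq_mul, Finset.card_univ]
  have hbdd : BddBelow {D : ℝ | 0 ≤ D ∧ DecouplingInequality p C φ k Finset.univ D} :=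
    ⟨0, fun D hD => hD.1⟩
  refine ⟨⟨le_csInf hne fun D hD => hD.1, fun f hf => ?_⟩, fun D hD => csInf_le hbdd hD⟩
  have hR : 0 ≤ (∑ j, ‖f j‖ ^ p.toReal) ^ (1 / p.toReal) := by positivity
  rcases hR.eq_or_lt with h0 | hpos
  · obtain ⟨D, hD⟩ := hne
    have := hD.2 f hf
    rw [← h0, mul_zero] at this ⊢
    exact this
  · rw [← div_le_iff₀ hpos]
    exact le_csInf hne fun D hD => (div_le_iff₀ hpos).2 (hD.2 f hf)

/-- The map `P = (P_1, …, P_n) : ℝ^d → ℝ^n` given by quadratic forms `P_1, …, P_n`, whose graph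
over `[0,1]^d` is the quadratic surface. -/
def quadraticMap {d n : ℕ} (P : Fin n → QuadraticForm ℝ (Fin d → ℝ)) :
    (Fin d → ℝ) → Fin n → ℝ :=
  fun t l => P l t

/-- The affine function `t' ↦ b + v · t'`, with gradient `v`. -/
def affineFun {m : ℕ} (v : EuclideanSpace ℝ (Fin m)) (b : ℝ) (t' : Fin m → ℝ) : ℝ :=
  b + ∑ i, v i * t' i

/-- The hyperplane `{(t', t_{m+1}) | t_{m+1} = b + v · t'}` of `ℝ^{m+1}`. -/
def graphHyperplane {m : ℕ} (v : EuclideanSpace ℝ (Fin m)) (b : ℝ) : Set (Fin (m + 1) → ℝ) :=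
  {t | t (Fin.last m) = affineFun v b (Fin.init t)}

/-- The restriction `P'(t') = P(t', b + v · t')` of `P` to the hyperplane
`t_{m+1} = b + v · t'`. -/
def restrictToHyperplane {m n : ℕ} (P : Fin n → QuadraticForm ℝ (Fin (m + 1) → ℝ))
    (v : EuclideanSpace ℝ (Fin m)) (b : ℝ) : (Fin m → ℝ) → Fin n → ℝ :=
  fun t' => quadraticMap P (Fin.snoc t' (affineFun v b t'))

open Classical in
/-- The dyadic cubes `□ ⊆ [0,1]^d` of side length `2^{-k}` with `c □ ∩ H ≠ ∅`. -/
def cubesNear {d : ℕ} (c : ℝ) (H : Set (Fin d → ℝ)) (k : ℕ) : Finset (DyadicIndex d k) :=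
  Finset.univ.filter fun j => (dilatedCube c j ∩ H).Nonempty

end

/-! Group the cubes near `H` into columns over dyadic cubes of side `ρ` in the first `d - 1`
variables. Subtracting from the graph variables the first-order Taylor polynomial of `P` at the
point of `H` over the corner, transversally to `H` as well as along it, and rescaling by `ρ` and
`ρ²`, turns a column into a neighbourhood of the graph of `P'`. For points at distance `r ≲ δ` from
`H` the error is of order `(rρ + r² + δ²)/ρ²`. So if `δρ ≲ ρ₁²`, the column is a cylinder over the
boxes of `P'` at scale `ρ₁/ρ` (`exists_const_rescaled_mem_uncertaintyBox`), and the decoupling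
constant of `P'` at that scale splits it into columns of side `ρ₁`
(`exists_const_column_decoupling`). Passing from `d - 1 + n` to `d + n` dimensions is Fubini over
slices (`decoupling_of_slices`).

The condition permits `ρ₁ ≈ (δρ)^{1/2}`, so each step about halves `log(ρ/δ)`, and after `O(log |log
δ|)` steps a column holds boundedly many cubes. The factors `(ρ₁/ρ)^{-Λ}` multiply to about
`δ^{-Λ}`; the factors `A` accumulate to `A^{O(log |log δ|)}`, a power of `|log δ|` with exponent
determined by `A` alone (`norm_sum_columnOver_le`, `pow_clog_le`). -/

noncomputable section

/-! ### Tensor products of Schwartz functions. -/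

open scoped ContDiff in
/-- The tensor product of two Schwartz functions. -/
def SchwartzMap.tensor {X Y : Type*} [NormedAddCommGroup X] [NormedSpace ℝ X]
    [NormedAddCommGroup Y] [NormedSpace ℝ Y] (f : 𝓢(X, ℂ)) (g : 𝓢(Y, ℂ)) : 𝓢(X × Y, ℂ) where
  toFun x := f x.1 * g x.2
  smooth' := ((f.smooth ⊤).comp contDiff_fst).mul ((g.smooth ⊤).comp contDiff_snd)
  decay' k n := by
    have hf : ContDiff ℝ ∞ (fun x : X × Y => f x.1) := (f.smooth ⊤).comp contDiff_fst
    have hg : ContDiff ℝ ∞ (fun x : X × Y => g x.2) := (g.smooth ⊤).comp contDiff_snd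
    have bf : ∀ (i : ℕ) (x : X × Y), ‖iteratedFDeriv ℝ i (fun x : X × Y => f x.1) x‖
        ≤ ‖iteratedFDeriv ℝ i f x.1‖ := by
      intro i x
      have := (ContinuousLinearMap.fst ℝ X Y).iteratedFDeriv_comp_right (f.smooth ⊤) x
        (i := i) (mod_cast le_top)
      change iteratedFDeriv ℝ i (fun x : X × Y => f x.1) x = _ at this
      rw [this]
      refine (ContinuousMultilinearMap.norm_compContinuousLinearMap_le _ _).trans ?_
      refine mul_le_of_le_one_right (norm_nonneg _) (Finset.prod_le_one (fun _ _ => norm_nonneg _)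
        fun _ _ => ContinuousLinearMap.norm_fst_le ..)
    have bg : ∀ (i : ℕ) (x : X × Y), ‖iteratedFDeriv ℝ i (fun x : X × Y => g x.2) x‖
        ≤ ‖iteratedFDeriv ℝ i g x.2‖ := by
      intro i x
      have := (ContinuousLinearMap.snd ℝ X Y).iteratedFDeriv_comp_right (g.smooth ⊤) x
        (i := i) (mod_cast le_top)
      change iteratedFDeriv ℝ i (fun x : X × Y => g x.2) x = _ at this
      rw [this]
      refine (ContinuousMultilinearMap.norm_compContinuousLinearMap_le _ _).trans ?_
      refine mul_le_of_le_one_right (norm_nonneg _) (Finset.prod_le_one (fun _ _ => norm_nonneg _)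
        fun _ _ => ContinuousLinearMap.norm_snd_le ..)
    choose A hA0 hA using f.decay
    choose B hB0 hB using g.decay
    refine ⟨∑ i ∈ Finset.range (n + 1), (n.choose i : ℝ) *
      (A k i * B 0 (n - i) + A 0 i * B k (n - i)), fun x => ?_⟩
    refine (mul_le_mul_of_nonneg_left
      (norm_iteratedFDeriv_mul_le hf hg x (mod_cast le_top)) (by positivity)).trans ?_
    rw [Finset.mul_sum]
    refine Finset.sum_le_sum fun i _ => ?_
    -- The product norm is a maximum, so the weight splits into one term for each factor; the other
    -- factor is controlled by its unweighted seminorm.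
    have hk : ‖x‖ ^ k ≤ ‖x.1‖ ^ k + ‖x.2‖ ^ k := by
      rcases max_choice ‖x.1‖ ‖x.2‖ with h | h <;> rw [Prod.norm_def, h] <;>
        linarith [pow_nonneg (norm_nonneg x.1) k, pow_nonneg (norm_nonneg x.2) k]
    have h1 := bf i x
    have h2 := bg (n - i) x
    have a1 := hA k i x.1
    have a2 := hA 0 i x.1
    have b1 := hB k (n - i) x.2
    have b2 := hB 0 (n - i) x.2
    rw [pow_zero, one_mul] at a2 b2
    set u := ‖iteratedFDeriv ℝ i f x.1‖
    set w := ‖iteratedFDeriv ℝ (n - i) g x.2‖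
    have hu : 0 ≤ u := norm_nonneg _
    have hw : 0 ≤ w := norm_nonneg _
    calc _ ≤ (‖x.1‖ ^ k + ‖x.2‖ ^ k) * (n.choose i * u * w) := by gcongr
      _ = n.choose i * ((‖x.1‖ ^ k * u) * w + u * (‖x.2‖ ^ k * w)) := by ring
      _ ≤ _ := by
        have := (hA0 k i).le
        have := (hA0 0 i).le
        gcongr

@[simp]
theorem SchwartzMap.tensor_apply {X Y : Type*} [NormedAddCommGroup X] [NormedSpace ℝ X]
    [NormedAddCommGroup Y] [NormedSpace ℝ Y] (f : 𝓢(X, ℂ)) (g : 𝓢(Y, ℂ)) (x : X × Y) :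
    f.tensor g x = f x.1 * g x.2 := rfl

/-! ### Fourier transforms in skew coordinates. -/

section ChangeOfVariables

open scoped InnerProductSpace

/-- The transpose of a linear isomorphism `V ≃ ℝ × W` with respect to the inner products. -/
def transposeEquiv {V W : Type*} [NormedAddCommGroup V] [InnerProductSpace ℝ V]
    [FiniteDimensional ℝ V] [NormedAddCommGroup W] [InnerProductSpace ℝ W]
    [FiniteDimensional ℝ W] (L : V ≃L[ℝ] ℝ × W) : (ℝ × W) ≃L[ℝ] V :=
  -- `ℝ × W` carries the sup norm, so the adjoint is taken on `WithLp 2 (ℝ × W)`.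
  let e : V ≃L[ℝ] WithLp 2 (ℝ × W) := L.trans (WithLp.prodContinuousLinearEquiv 2 ℝ ℝ W).symm
  (WithLp.prodContinuousLinearEquiv 2 ℝ ℝ W).symm.trans <|
    ContinuousLinearEquiv.equivOfInverse (ContinuousLinearMap.adjoint (e : V →L[ℝ] _))
      (ContinuousLinearMap.adjoint (e.symm : _ →L[ℝ] V))
      (fun x => by
        rw [← ContinuousLinearMap.comp_apply, ← ContinuousLinearMap.adjoint_comp]
        simp [ContinuousLinearMap.adjoint_id])
      (fun x => by
        rw [← ContinuousLinearMap.comp_apply, ← ContinuousLinearMap.adjoint_comp]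
        simp [ContinuousLinearMap.adjoint_id])

theorem inner_transposeEquiv {V W : Type*} [NormedAddCommGroup V] [InnerProductSpace ℝ V]
    [FiniteDimensional ℝ V] [NormedAddCommGroup W] [InnerProductSpace ℝ W]
    [FiniteDimensional ℝ W] (L : V ≃L[ℝ] ℝ × W) (ξ : V) (x : ℝ × W) :
    ⟪ξ, transposeEquiv L x⟫_ℝ = (L ξ).1 * x.1 + ⟪(L ξ).2, x.2⟫_ℝ := by
  simp [transposeEquiv, ContinuousLinearMap.adjoint_inner_right, mul_comm]

/-- A linear isomorphism carries a Haar measure to a multiple of any other one. -/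
theorem exists_map_eq_smul {X Y : Type*} [NormedAddCommGroup X] [NormedSpace ℝ X]
    [MeasurableSpace X] [BorelSpace X] [NormedAddCommGroup Y] [NormedSpace ℝ Y]
    [FiniteDimensional ℝ Y] [MeasurableSpace Y] [BorelSpace Y] (T : X ≃L[ℝ] Y)
    (μ : Measure X) (ν : Measure Y) [μ.IsAddHaarMeasure] [ν.IsAddHaarMeasure] :
    ∃ c : ℝ≥0∞, c ≠ 0 ∧ c ≠ ∞ ∧ μ.map T = c • ν := by
  have : (μ.map T).IsAddHaarMeasure := T.isAddHaarMeasure_map _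
  have : SecondCountableTopology Y := by
    have := FiniteDimensional.proper_real Y
    infer_instance
  exact ⟨Measure.addHaarScalarFactor (μ.map T) ν,
    by simpa using (Measure.addHaarScalarFactor_pos_of_isAddHaarMeasure _ _).ne', ENNReal.coe_ne_top,
    Measure.isAddLeftInvariant_eq_smul (μ.map T) ν⟩

/-- The Fourier transform of a tensor product, in skew coordinates. -/
theorem fourier_tensor_comp {V W : Type*} [NormedAddCommGroup V] [InnerProductSpace ℝ V]
    [FiniteDimensional ℝ V] [MeasurableSpace V] [BorelSpace V] [NormedAddCommGroup W]
    [InnerProductSpace ℝ W] [FiniteDimensional ℝ W] [MeasurableSpace W] [BorelSpace W]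
    (L : V ≃L[ℝ] ℝ × W) : ∃ c : ℂ, c ≠ 0 ∧
    ∀ (χ : 𝓢(ℝ, ℂ)) (φ : 𝓢(W, ℂ)) (ξ₀ : W) (x : ℝ × W),
      𝓕 (SchwartzMap.compCLMOfContinuousLinearEquiv ℂ L
        (χ.tensor (SchwartzMap.compSubConstCLM ℂ ξ₀ φ))) (transposeEquiv L x)
      = c * (𝓕 χ x.1 * (Real.fourierChar (-⟪ξ₀, x.2⟫_ℝ) • 𝓕 φ x.2)) := by
  obtain ⟨c, h0, h1, h⟩ := exists_map_eq_smul L volume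
    ((volume : Measure ℝ).prod (volume : Measure W))
  refine ⟨c.toReal, ?_, fun χ φ ξ₀ x => ?_⟩
  · simp [ENNReal.toReal_eq_zero_iff, h0, h1]
  have key : ∀ H : ℝ × W → ℂ, ∫ ξ, H (L ξ) =
      c.toReal * ∫ y, H y ∂((volume : Measure ℝ).prod (volume : Measure W)) := by
    intro H
    have := integral_map_equiv L.toHomeomorph.toMeasurableEquiv (μ := volume) H
    simp only [Homeomorph.toMeasurableEquiv_coe, ContinuousLinearEquiv.coe_toHomeomorph] at this
    rw [← this, h, integral_smul_measure]
    simp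
  simp only [SchwartzMap.fourier_coe, Real.fourier_eq]
  calc _ = ∫ ξ, (Real.fourierChar (-⟪(L ξ).1, x.1⟫_ℝ) • χ (L ξ).1) *
          (Real.fourierChar (-⟪(L ξ).2, x.2⟫_ℝ) • φ ((L ξ).2 - ξ₀)) := by
        refine integral_congr_ae (.of_forall fun ξ => ?_)
        simp only [inner_transposeEquiv, SchwartzMap.compCLMOfContinuousLinearEquiv_apply,
          Function.comp_apply, SchwartzMap.tensor_apply, SchwartzMap.compSubConstCLM_apply,
          neg_add, AddChar.map_add_eq_mul, Circle.smul_def, smul_eq_mul, Circle.coe_mul,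
          RCLike.inner_apply, conj_trivial, mul_comm x.1]
        ring
    _ = _ := by
        refine (key (fun y => (Real.fourierChar (-⟪y.1, x.1⟫_ℝ) • χ y.1) *
          (Real.fourierChar (-⟪y.2, x.2⟫_ℝ) • φ (y.2 - ξ₀)))).trans ?_
        rw [integral_prod_mul (fun y : ℝ => Real.fourierChar (-⟪y, x.1⟫_ℝ) • χ y)
          (fun y : W => Real.fourierChar (-⟪y, x.2⟫_ℝ) • φ (y - ξ₀))]
        congr 2
        rw [Circle.smul_def, smul_eq_mul, ← integral_sub_right_eq_self _ (-ξ₀), ← integral_const_mul]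
        refine integral_congr_ae (.of_forall fun ξ => ?_)
        simp only [sub_neg_eq_add, add_sub_cancel_right, inner_add_left, neg_add,
          AddChar.map_add_eq_mul, Circle.smul_def, smul_eq_mul, Circle.coe_mul]
        ring

end ChangeOfVariables

/-! ### Fourier supports of slices and cylindrical decoupling. -/

section Slicing

open scoped InnerProductSpace

/-- If `f̂` is supported in `U` and the affine map `ξ ↦ (L ξ).2 - ξ₀` sends `U` into `U'`, then almost
every slice of `f`, suitably modulated, has Fourier support in `U'`, when tested against a single
function. -/
theorem ae_integral_slice_eq_zero {V W : Type*} [NormedAddCommGroup V] [InnerProductSpace ℝ V]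
    [FiniteDimensional ℝ V] [MeasurableSpace V] [BorelSpace V] [NormedAddCommGroup W]
    [InnerProductSpace ℝ W] [FiniteDimensional ℝ W] [MeasurableSpace W] [BorelSpace W]
    {p : ℝ≥0∞} [Fact (1 ≤ p)] (L : V ≃L[ℝ] ℝ × W) (ξ₀ : W) {U : Set V} {U' : Set W}
    (hU : ∀ ξ ∈ U, (L ξ).2 - ξ₀ ∈ U') (f : Lp ℂ p (volume : Measure V))
    (hf : Distribution.IsVanishingOn (𝓕 (Lp.toTemperedDistribution f) : 𝓢'(V, ℂ)) Uᶜ)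
    (φ : 𝓢(W, ℂ)) (hφ : tsupport φ ⊆ U'ᶜ) :
    ∀ᵐ z : ℝ, ∫ y : W, (Real.fourierChar (-⟪ξ₀, y⟫_ℝ) • 𝓕 φ y) * f (transposeEquiv L (z, y)) = 0 := by
  obtain ⟨c, hc, hcF⟩ := fourier_tensor_comp L
  obtain ⟨a, ha0, ha1, ha⟩ := exists_map_eq_smul (transposeEquiv L)
    ((volume : Measure ℝ).prod (volume : Measure W)) volume
  set T := transposeEquiv L
  set E : W → ℂ := fun y => Real.fourierChar (-⟪ξ₀, y⟫_ℝ) • 𝓕 φ y with hE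
  have key : ∀ ψ : 𝓢(ℝ, ℂ),
      Integrable (fun x : ℝ × W => ψ x.1 * (E x.2 * f (T x)))
        ((volume : Measure ℝ).prod (volume : Measure W)) ∧
      ∫ x : ℝ × W, ψ x.1 * (E x.2 * f (T x)) ∂((volume : Measure ℝ).prod (volume : Measure W))
        = 0 := by
    intro ψ
    -- In the coordinates `T`, the transform of `Φ` is a multiple of `ψ ⊗ E`. The support of `Φ` is
    -- a cylinder over a translate of that of `φ`, so it misses `U`.
    set Φ : 𝓢(V, ℂ) := SchwartzMap.compCLMOfContinuousLinearEquiv ℂ L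
        ((𝓕⁻ ψ).tensor (SchwartzMap.compSubConstCLM ℂ ξ₀ φ)) with hΦ
    have hΦs : tsupport Φ ⊆ Uᶜ := by
      have h1 : tsupport Φ ⊆ (fun ξ => (L ξ).2 - ξ₀) ⁻¹' tsupport φ := by
        refine closure_minimal (fun ξ hξ => subset_tsupport _ ?_)
          ((isClosed_tsupport _).preimage (by fun_prop))
        simp only [hΦ, Function.mem_support, SchwartzMap.compCLMOfContinuousLinearEquiv_apply,
          Function.comp_apply, SchwartzMap.tensor_apply, SchwartzMap.compSubConstCLM_apply] at hξ
        exact right_ne_zero_of_mul hξ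
      exact fun ξ hξ hξU => hφ (h1 hξ) (hU ξ hξU)
    have h0 : ∫ x, 𝓕 Φ x • f x = 0 := by
      have := hf Φ hΦs
      rwa [TemperedDistribution.fourier_apply, Lp.toTemperedDistribution_apply] at this
    have hi : Integrable (fun x => 𝓕 Φ x * f x) := by
      have := ENNReal.HolderConjugate.inv_one_sub_inv' (Fact.out : 1 ≤ p)
      have := (Lp.memLp f).integrable_mul ((𝓕 Φ).memLp (1 - p⁻¹)⁻¹ volume)
      refine this.congr (.of_forall fun x => ?_)
      simp [mul_comm]
    have hpt : ∀ x : ℝ × W, ψ x.1 * (E x.2 * f (T x)) = c⁻¹ * (𝓕 Φ (T x) * f (T x)) := by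
      intro x
      rw [hΦ, hcF (𝓕⁻ ψ) φ ξ₀ x, FourierTransform.fourier_fourierInv_eq]
      simp only [hE]
      field_simp
    have hiT : Integrable (fun x : ℝ × W => 𝓕 Φ (T x) * f (T x))
        ((volume : Measure ℝ).prod (volume : Measure W)) := by
      have := integrable_map_equiv T.toHomeomorph.toMeasurableEquiv
        (μ := (volume : Measure ℝ).prod (volume : Measure W)) (fun x => 𝓕 Φ x * f x)
      simp only [Homeomorph.toMeasurableEquiv_coe, ContinuousLinearEquiv.coe_toHomeomorph] at this
      refine this.1 ?_
      rw [ha]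
      exact hi.smul_measure ha1
    have hIT : ∫ x : ℝ × W, 𝓕 Φ (T x) * f (T x)
        ∂((volume : Measure ℝ).prod (volume : Measure W)) = 0 := by
      have := integral_map_equiv T.toHomeomorph.toMeasurableEquiv
        (μ := (volume : Measure ℝ).prod (volume : Measure W)) (fun x => 𝓕 Φ x * f x)
      simp only [Homeomorph.toMeasurableEquiv_coe, ContinuousLinearEquiv.coe_toHomeomorph] at this
      rw [← this, ha, integral_smul_measure]
      simp only [smul_eq_mul] at h0
      rw [h0, smul_zero]
    simp only [hpt]
    exact ⟨hiT.const_mul _, by rw [integral_const_mul, hIT, mul_zero]⟩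
  have key2 : ∀ ψ : 𝓢(ℝ, ℂ), Integrable (fun z => ψ z * ∫ y, E y * f (T (z, y))) ∧
      ∫ z, ψ z * ∫ y, E y * f (T (z, y)) = 0 := by
    intro ψ
    obtain ⟨h1, h2⟩ := key ψ
    refine ⟨?_, ?_⟩
    · refine h1.integral_prod_left.congr (.of_forall fun z => ?_)
      simp only [integral_const_mul]
    · rw [← h2, integral_prod _ h1]
      simp only [integral_const_mul]
  -- The slice integral, as a function of `z`, annihilates every test function. Its local
  -- integrability follows by testing against a bump equal to `1` on `K`.
  refine ae_eq_zero_of_integral_contDiff_smul_eq_zero ?_ ?_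
  · rw [locallyIntegrable_iff]
    intro K hK
    obtain ⟨R, hR⟩ := hK.isBounded.subset_closedBall 0
    let b : ContDiffBump (0 : ℝ) := ⟨max R 1, max R 1 + 1, by positivity, by linarith⟩
    have hb : HasCompactSupport (Complex.ofRealCLM ∘ b) := b.hasCompactSupport.comp_left rfl
    have hb' : ContDiff ℝ (⊤ : ℕ∞) (Complex.ofRealCLM ∘ b) := Complex.ofRealCLM.contDiff.comp b.contDiff
    refine ((key2 (hb.toSchwartzMap hb')).1.integrableOn (s := K)).congr_fun (fun z hz => ?_)
      hK.measurableSet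
    have : b z = 1 := b.one_of_mem_closedBall
      (Metric.closedBall_subset_closedBall (le_max_left _ _) (hR hz))
    simp [this, hE]
  · intro g hg hgc
    have hb : HasCompactSupport (Complex.ofRealCLM ∘ g) := hgc.comp_left rfl
    have hb' : ContDiff ℝ (⊤ : ℕ∞) (Complex.ofRealCLM ∘ g) := Complex.ofRealCLM.contDiff.comp hg
    rw [← (key2 (hb.toSchwartzMap hb')).2]
    refine integral_congr_ae (.of_forall fun z => ?_)
    simp [hE]

/-- Vanishing of the Fourier transform of an `L^p` function on a set can be tested on a countable
family of test functions. -/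
theorem exists_countable_isVanishingOn {W : Type*} [NormedAddCommGroup W]
    [InnerProductSpace ℝ W] [FiniteDimensional ℝ W] [MeasurableSpace W] [BorelSpace W]
    {p : ℝ≥0∞} [Fact (1 ≤ p)] (hp : p ≠ ∞) (U : Set W) :
    ∃ S : Set 𝓢(W, ℂ), S.Countable ∧ (∀ φ ∈ S, tsupport φ ⊆ U) ∧
      ∀ g : Lp ℂ p (volume : Measure W), (∀ φ ∈ S, ∫ y, 𝓕 φ y * g y = 0) →
        Distribution.IsVanishingOn (𝓕 (Lp.toTemperedDistribution g) : 𝓢'(W, ℂ)) U := by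
  have : Fact (p ≠ ∞) := ⟨hp⟩
  have happ : ∀ (g : Lp ℂ p (volume : Measure W)) (φ : 𝓢(W, ℂ)),
      (𝓕 (Lp.toTemperedDistribution g) : 𝓢'(W, ℂ)) φ = ∫ y, 𝓕 φ y * g y := by
    intro g φ
    rw [TemperedDistribution.fourier_apply, Lp.toTemperedDistribution_apply]
    rfl
  have hcont : ∀ φ : 𝓢(W, ℂ), Continuous fun g : Lp ℂ p (volume : Measure W) =>
      ∫ y, 𝓕 φ y * g y := by
    intro φ
    simp only [← happ, TemperedDistribution.fourier_apply]
    exact (PointwiseConvergenceCLM.evalCLM (RingHom.id ℂ) ℂ (𝓕 φ)).continuous.comp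
      (Lp.toTemperedDistributionCLM ℂ (volume : Measure W) p).continuous
  -- Each test function detects an open subset of `L^p`. Since `L^p` is second countable for `p <
  -- ∞`, countably many of these sets already cover the union.
  obtain ⟨S, hSU, hS, hu⟩ := TopologicalSpace.isOpen_biUnion_countable
    {φ : 𝓢(W, ℂ) | tsupport φ ⊆ U}
    (fun φ => {g : Lp ℂ p (volume : Measure W) | ∫ y, 𝓕 φ y * g y ≠ 0})
    (fun φ _ => isOpen_ne.preimage (hcont φ))
  refine ⟨S, hS, hSU, fun g hg φ hφ => ?_⟩
  rw [happ]
  by_contra hne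
  have : g ∈ ⋃ φ ∈ S, {g : Lp ℂ p (volume : Measure W) | ∫ y, 𝓕 φ y * g y ≠ 0} := by
    rw [hu]
    exact Set.mem_biUnion (show φ ∈ {φ : 𝓢(W, ℂ) | tsupport φ ⊆ U} from hφ) hne
  simp only [Set.mem_iUnion] at this
  obtain ⟨φ', h1, h2⟩ := this
  exact h2 (hg φ' h1)

/-- The `p`-th power of a decoupling inequality, as an inequality between integrals. -/
theorem norm_sum_le_iff_lintegral {α ι : Type*} [MeasurableSpace α] {μ : Measure α}
    {p : ℝ≥0∞} [hp : Fact (1 ≤ p)] (hp' : p ≠ ∞) (s : Finset ι) (f : ι → Lp ℂ p μ) {D : ℝ}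
    (hD : 0 ≤ D) :
    ‖∑ i ∈ s, f i‖ ≤ D * (∑ i ∈ s, ‖f i‖ ^ p.toReal) ^ (1 / p.toReal) ↔
      ∫⁻ x, ‖∑ i ∈ s, f i x‖ₑ ^ p.toReal ∂μ
        ≤ ENNReal.ofReal D ^ p.toReal * ∑ i ∈ s, ∫⁻ x, ‖f i x‖ₑ ^ p.toReal ∂μ := by
  have hp0 : p ≠ 0 := (zero_lt_one.trans_le hp.out).ne'
  have hpr : 0 < p.toReal := ENNReal.toReal_pos hp0 hp'
  have hn : ∀ g : Lp ℂ p μ, ∫⁻ x, ‖g x‖ₑ ^ p.toReal ∂μ = ENNReal.ofReal (‖g‖ ^ p.toReal) := by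
    intro g
    rw [← ENNReal.ofReal_rpow_of_nonneg (norm_nonneg _) hpr.le, ofReal_norm, Lp.enorm_def,
      eLpNorm_eq_lintegral_rpow_enorm_toReal hp0 hp', ← ENNReal.rpow_mul,
      one_div_mul_cancel hpr.ne', ENNReal.rpow_one]
  have hs : ∫⁻ x, ‖∑ i ∈ s, f i x‖ₑ ^ p.toReal ∂μ
      = ∫⁻ x, ‖(∑ i ∈ s, f i : Lp ℂ p μ) x‖ₑ ^ p.toReal ∂μ := by
    refine lintegral_congr_ae ?_
    filter_upwards [Lp.coeFn_fun_finsetSum s f] with x hx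
    rw [hx]
  have hS : 0 ≤ ∑ i ∈ s, ‖f i‖ ^ p.toReal := Finset.sum_nonneg fun i _ => by positivity
  rw [hs]
  simp only [hn]
  rw [← ENNReal.ofReal_sum_of_nonneg (fun i _ => by positivity),
    ENNReal.ofReal_rpow_of_nonneg hD hpr.le, ← ENNReal.ofReal_mul (by positivity),
    ENNReal.ofReal_le_ofReal_iff (by positivity),
    ← Real.rpow_le_rpow_iff (norm_nonneg _) (by positivity) hpr,
    Real.mul_rpow hD (by positivity), ← Real.rpow_mul hS, one_div_mul_cancel hpr.ne',
    Real.rpow_one]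

/-- A decoupling inequality for functions on `W` implies one for functions on `V ≃ ℝ × W`, whose
Fourier supports are cylindrical over those in `W`. -/
theorem decoupling_of_slices {V W ι : Type*} [NormedAddCommGroup V] [InnerProductSpace ℝ V]
    [FiniteDimensional ℝ V] [MeasurableSpace V] [BorelSpace V] [NormedAddCommGroup W]
    [InnerProductSpace ℝ W] [FiniteDimensional ℝ W] [MeasurableSpace W] [BorelSpace W]
    {p : ℝ≥0∞} [hp : Fact (1 ≤ p)] (hp' : p ≠ ∞) (L : V ≃L[ℝ] ℝ × W) (ξ₀ : W) (s : Finset ι)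
    {U : ι → Set V} {U' : ι → Set W}
    (hU : ∀ i ∈ s, ∀ ξ ∈ U i, (L ξ).2 - ξ₀ ∈ U' i) {D : ℝ} (hD : 0 ≤ D)
    (hdec : ∀ g : ι → Lp ℂ p (volume : Measure W),
      (∀ i ∈ s, Distribution.IsVanishingOn
        (𝓕 (Lp.toTemperedDistribution (g i)) : 𝓢'(W, ℂ)) (U' i)ᶜ) →
      ‖∑ i ∈ s, g i‖ ≤ D * (∑ i ∈ s, ‖g i‖ ^ p.toReal) ^ (1 / p.toReal))
    (f : ι → Lp ℂ p (volume : Measure V))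
    (hf : ∀ i ∈ s, Distribution.IsVanishingOn
      (𝓕 (Lp.toTemperedDistribution (f i)) : 𝓢'(V, ℂ)) (U i)ᶜ) :
    ‖∑ i ∈ s, f i‖ ≤ D * (∑ i ∈ s, ‖f i‖ ^ p.toReal) ^ (1 / p.toReal) := by
  have hp0 : p ≠ 0 := (zero_lt_one.trans_le hp.out).ne'
  obtain ⟨a, ha0, ha1, ha⟩ := exists_map_eq_smul (transposeEquiv L)
    ((volume : Measure ℝ).prod (volume : Measure W)) volume
  set T := transposeEquiv L with hT
  have hfm : ∀ i, Measurable (f i : V → ℂ) := fun i => (Lp.stronglyMeasurable (f i)).measurable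
  have hTm : Measurable T := T.continuous.measurable
  have htr : ∀ F : V → ℝ≥0∞, Measurable F →
      a * ∫⁻ x, F x = ∫⁻ z : ℝ, ∫⁻ y : W, F (T (z, y)) := by
    intro F hF
    have := lintegral_prod (μ := (volume : Measure ℝ)) (ν := (volume : Measure W))
      (fun x => F (T x)) (hF.comp hTm).aemeasurable
    rw [← this, ← lintegral_map hF hTm, ha, lintegral_smul_measure, smul_eq_mul]
  rw [norm_sum_le_iff_lintegral hp' s f hD]
  -- The Jacobian factor `a` turns both sides into iterated integrals, which are compared for almost
  -- every `z` separately.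
  refine (ENNReal.mul_le_mul_iff_right ha0 ha1).1 ?_
  have hm1 : Measurable fun x => ‖∑ i ∈ s, f i x‖ₑ ^ p.toReal :=
    ((Finset.measurable_sum s fun i _ => hfm i).enorm).pow_const _
  have hm2 : ∀ i, Measurable fun x => ‖f i x‖ₑ ^ p.toReal := fun i => (hfm i).enorm.pow_const _
  rw [htr _ hm1, mul_left_comm, Finset.mul_sum]
  simp only [htr _ (hm2 _)]
  have hm3 : ∀ i, Measurable fun z : ℝ => ∫⁻ y : W, ‖f i (T (z, y))‖ₑ ^ p.toReal :=
    fun i => ((hm2 i).comp hTm).lintegral_prod_right'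
  rw [← lintegral_finsetSum _ fun i _ => hm3 i,
    ← lintegral_const_mul _ (Finset.measurable_sum _ fun i _ => hm3 i)]
  refine lintegral_mono_ae ?_
  have hfin : ∀ i ∈ s, ∀ᵐ z : ℝ, ∫⁻ y : W, ‖f i (T (z, y))‖ₑ ^ p.toReal < ∞ := by
    intro i _
    refine ae_lt_top (hm3 i) ?_
    have h1 := lintegral_rpow_enorm_lt_top_of_eLpNorm_lt_top hp0 hp' (Lp.memLp (f i)).2
    rw [← htr _ (hm2 i)]
    exact ENNReal.mul_ne_top ha1 h1.ne
  -- The null set of bad slices depends on the test function; a countable family has a common one.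
  choose S hSc hSs hS using fun i => exists_countable_isVanishingOn (W := W) hp' (U' i)ᶜ
  have hvan : ∀ i ∈ s, ∀ᵐ z : ℝ, ∀ φ ∈ S i,
      ∫ y : W, (Real.fourierChar (-⟪ξ₀, y⟫_ℝ) • 𝓕 φ y) * f i (T (z, y)) = 0 := by
    intro i hi
    rw [ae_ball_iff (hSc i)]
    exact fun φ hφ => ae_integral_slice_eq_zero L ξ₀ (hU i hi) (f i) (hf i hi) φ (hSs i φ hφ)
  rw [← Finset.eventually_all] at hfin hvan
  filter_upwards [hfin, hvan] with z h1 h2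
  -- The unimodular factor translates frequencies by `-ξ₀` and preserves all norms.
  let G : ι → W → ℂ := fun i y => Real.fourierChar (-⟪ξ₀, y⟫_ℝ) • f i (T (z, y))
  have hGn : ∀ i y, ‖G i y‖ₑ = ‖f i (T (z, y))‖ₑ := by
    intro i y
    simp [G, ← ofReal_norm]
  have hGm : ∀ i, Measurable (G i) := by
    intro i
    have : Measurable fun y : W => (Real.fourierChar (-⟪ξ₀, y⟫_ℝ) : ℂ) := by
      refine Continuous.measurable ?_
      fun_prop
    simp only [G, Circle.smul_def, smul_eq_mul]
    exact this.mul ((hfm i).comp (hTm.comp measurable_prodMk_left))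
  have hG : ∀ i ∈ s, MemLp (G i) p := by
    intro i hi
    refine ⟨(hGm i).aestronglyMeasurable, ?_⟩
    rw [eLpNorm_lt_top_iff_lintegral_rpow_enorm_lt_top hp0 hp']
    simpa only [hGn] using h1 i hi
  classical
  let g : ι → Lp ℂ p (volume : Measure W) := fun i =>
    if h : i ∈ s then (hG i h).toLp else 0
  have hg : ∀ i ∈ s, g i =ᵐ[volume] G i := by
    intro i hi
    simp only [g, hi, dif_pos]
    exact (hG i hi).coeFn_toLp
  have h3 := hdec g fun i hi => hS i (g i) fun φ hφ => by
    rw [← h2 i hi φ hφ]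
    refine integral_congr_ae ?_
    filter_upwards [hg i hi] with y hy
    rw [hy]
    simp only [G, Circle.smul_def, smul_eq_mul]
    ring
  rw [norm_sum_le_iff_lintegral hp' s g hD] at h3
  have e1 : ∫⁻ y, ‖∑ i ∈ s, g i y‖ₑ ^ p.toReal
      = ∫⁻ y : W, ‖∑ i ∈ s, f i (T (z, y))‖ₑ ^ p.toReal := by
    refine lintegral_congr_ae ?_
    have : ∀ᵐ y : W, ∀ i ∈ s, g i y = G i y := by
      rw [Filter.eventually_all_finset]
      exact hg
    filter_upwards [this] with y hy
    rw [Finset.sum_congr rfl hy]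
    simp [G, ← Finset.smul_sum, ← ofReal_norm]
  have e2 : ∀ i ∈ s, ∫⁻ y, ‖g i y‖ₑ ^ p.toReal
      = ∫⁻ y : W, ‖f i (T (z, y))‖ₑ ^ p.toReal := by
    intro i hi
    refine lintegral_congr_ae ?_
    filter_upwards [hg i hi] with y hy
    rw [hy, hGn]
  rw [e1, Finset.sum_congr rfl e2] at h3
  exact h3

end Slicing

/-! ### Quadratic forms on a hyperplane and the affine rescaling. -/

section Geometry

open QuadraticMap

/-- Quadratic forms in finitely many variables are bounded by the square of the norm. -/
theorem exists_quadraticForm_bound {N n : ℕ} (P : Fin n → QuadraticForm ℝ (Fin N → ℝ)) :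
    ∃ K : ℝ, 0 ≤ K ∧ ∀ l x, |P l x| ≤ K * ‖x‖ ^ 2 ∧ ∀ y, |polar (P l) x y| ≤ K * ‖x‖ * ‖y‖ := by
  have hB : ∀ l, ∃ K : ℝ, 0 ≤ K ∧ ∀ x y, |polar (P l) x y| ≤ K * ‖x‖ * ‖y‖ := by
    intro l
    let B : (Fin N → ℝ) →L[ℝ] (Fin N → ℝ) →L[ℝ] ℝ := LinearMap.toContinuousLinearMap
      ((LinearMap.toContinuousLinearMap : ((Fin N → ℝ) →ₗ[ℝ] ℝ) ≃ₗ[ℝ] _).toLinearMap ∘ₗ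
        (P l).polarBilin)
    exact ⟨‖B‖, ContinuousLinearMap.opNorm_nonneg _, fun x y => by simpa [B] using B.le_opNorm₂ x y⟩
  choose K hK0 hK using hB
  have hle : ∀ l, K l ≤ ∑ i, K i :=
    fun l => Finset.single_le_sum (f := K) (fun i _ => hK0 i) (Finset.mem_univ l)
  have hpol : ∀ l x y, |polar (P l) x y| ≤ (∑ i, K i) * ‖x‖ * ‖y‖ := fun l x y =>
    (hK l x y).trans (by gcongr; exact hle l)
  refine ⟨∑ i, K i, Finset.sum_nonneg fun i _ => hK0 i, fun l x => ⟨?_, hpol l x⟩⟩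
  have h1 := hpol l x x
  rw [polar_self, nsmul_eq_mul, Nat.cast_ofNat, abs_mul] at h1
  have h2 : |(2 : ℝ)| = 2 := abs_two
  rw [h2] at h1
  nlinarith [abs_nonneg (P l x)]

theorem quadraticForm_add_smul {X : Type*} [AddCommGroup X] [Module ℝ X] (Q : QuadraticForm ℝ X)
    (x y : X) (r : ℝ) : Q (x + r • y) = Q x + r * polar Q x y + r ^ 2 * Q y := by
  rw [QuadraticMap.map_add Q, QuadraticMap.map_smul, polar_smul_right, smul_eq_mul, smul_eq_mul]
  ring

/-- The derivative of a tuple of quadratic polynomials. -/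
theorem fderiv_quadraticForm_comp {M N n : ℕ} (P : Fin n → QuadraticForm ℝ (Fin N → ℝ))
    (A : (Fin M → ℝ) →ₗ[ℝ] (Fin N → ℝ)) (x₀ : Fin N → ℝ) (a s : Fin M → ℝ) (l : Fin n) :
    fderiv ℝ (fun t l => P l (x₀ + A t)) a s l = polar (P l) (x₀ + A a) (A s) := by
  obtain ⟨K, hK0, hK⟩ := exists_quadraticForm_bound P
  have h : ∀ l, HasFDerivAt (fun t => P l (x₀ + A t))
      (LinearMap.toContinuousLinearMap ((P l).polarBilin (x₀ + A a) ∘ₗ A)) a := by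
    intro l
    rw [hasFDerivAt_iff_isLittleO_nhds_zero]
    -- The first-order remainder of a quadratic form is exactly its value at the increment.
    have h1 : (fun h => P l (x₀ + A (a + h)) - P l (x₀ + A a)
        - LinearMap.toContinuousLinearMap ((P l).polarBilin (x₀ + A a) ∘ₗ A) h)
        = fun h => P l (A h) := by
      funext h
      simp only [LinearMap.coe_toContinuousLinearMap', LinearMap.comp_apply, polarBilin_apply_apply]
      rw [_root_.map_add A, ← add_assoc, QuadraticMap.map_add (P l) (x₀ + A a)]
      ring
    rw [h1]
    have h2 : (fun h => P l (A h)) =O[nhds 0] fun h : Fin M → ℝ => ‖h‖ ^ 2 := by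
      refine Asymptotics.IsBigO.of_bound (K * ‖LinearMap.toContinuousLinearMap A‖ ^ 2)
        (.of_forall fun h => ?_)
      have h3 := (LinearMap.toContinuousLinearMap A).le_opNorm h
      rw [LinearMap.coe_toContinuousLinearMap'] at h3
      rw [Real.norm_eq_abs, Real.norm_eq_abs, abs_of_nonneg (by positivity : 0 ≤ ‖h‖ ^ 2),
        mul_assoc, ← mul_pow]
      exact ((hK l (A h)).1).trans (by gcongr)
    exact h2.trans_isLittleO (by simpa using Asymptotics.isLittleO_norm_pow_id one_lt_two)
  rw [(hasFDerivAt_pi.2 h).fderiv]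
  simp

/-- The linear part `t' ↦ (t', v · t')` of the parametrization of a hyperplane. -/
def hyperplaneLift {m : ℕ} (v : EuclideanSpace ℝ (Fin m)) :
    (Fin m → ℝ) →ₗ[ℝ] (Fin (m + 1) → ℝ) where
  toFun t := Fin.snoc t (∑ i, v i * t i)
  map_add' x y := by
    funext i
    refine Fin.lastCases ?_ (fun i => ?_) i
    · simp [mul_add, Finset.sum_add_distrib]
    · simp
  map_smul' c x := by
    funext i
    refine Fin.lastCases ?_ (fun i => ?_) i
    · simp [Finset.mul_sum, mul_left_comm]
    · simp

/-- The last coordinate vector. -/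
def lastVector (m : ℕ) : Fin (m + 1) → ℝ := Pi.single (Fin.last m) 1

theorem snoc_affineFun {m : ℕ} (v : EuclideanSpace ℝ (Fin m)) (b : ℝ) (t : Fin m → ℝ) :
    (Fin.snoc t (affineFun v b t) : Fin (m + 1) → ℝ) =
      b • lastVector m + hyperplaneLift v t := by
  funext i
  refine Fin.lastCases ?_ (fun i => ?_) i
  · simp [affineFun, hyperplaneLift, lastVector]
  · simp [hyperplaneLift, lastVector]

/-- Separates the vertical projection to the hyperplane from the signed vertical distance `r`, the
small parameter of the rescaling. -/
theorem eq_lift_add_smul_lastVector {m : ℕ} (v : EuclideanSpace ℝ (Fin m)) (b : ℝ)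
    (t : Fin (m + 1) → ℝ) :
    t = (b • lastVector m + hyperplaneLift v (Fin.init t))
      + (t (Fin.last m) - affineFun v b (Fin.init t)) • lastVector m := by
  rw [← snoc_affineFun]
  funext i
  refine Fin.lastCases ?_ (fun i => ?_) i
  · simp [lastVector]
  · simp [lastVector, Fin.init]

theorem restrictToHyperplane_eq {m n : ℕ} (P : Fin n → QuadraticForm ℝ (Fin (m + 1) → ℝ))
    (v : EuclideanSpace ℝ (Fin m)) (b : ℝ) : restrictToHyperplane P v b =
      fun t l => P l (b • lastVector m + hyperplaneLift v t) := by
  funext t l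
  simp [restrictToHyperplane, quadraticMap, snoc_affineFun]

theorem abs_sum_mul_le {m : ℕ} {v : EuclideanSpace ℝ (Fin m)} {M B : ℝ} (hv : ‖v‖ ≤ M)
    {t : Fin m → ℝ} (ht : ∀ i, |t i| ≤ B) : |∑ i, v i * t i| ≤ m * M * B := by
  refine (Finset.abs_sum_le_sum_abs _ _).trans ?_
  calc ∑ i, |v i * t i| ≤ ∑ _i : Fin m, M * B := by
        refine Finset.sum_le_sum fun i _ => ?_
        rw [abs_mul]
        have h1 : |v i| ≤ M := (PiLp.norm_apply_le v i).trans hv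
        exact mul_le_mul h1 (ht i) (abs_nonneg _) ((abs_nonneg _).trans h1)
    _ = _ := by simp [mul_assoc]

theorem norm_hyperplaneLift_le {m : ℕ} {v : EuclideanSpace ℝ (Fin m)} {M B : ℝ} (hv : ‖v‖ ≤ M)
    (hB : 0 ≤ B) {t : Fin m → ℝ} (ht : ∀ i, |t i| ≤ B) :
    ‖hyperplaneLift v t‖ ≤ (1 + m * M) * B := by
  have hM : 0 ≤ M := (norm_nonneg v).trans hv
  refine (pi_norm_le_iff_of_nonneg (by positivity)).2 fun i => ?_
  refine Fin.lastCases ?_ (fun i => ?_) i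
  · have := abs_sum_mul_le hv ht
    simp only [hyperplaneLift, LinearMap.coe_mk, AddHom.coe_mk, Fin.snoc_last, Real.norm_eq_abs]
    linarith
  · have := ht i
    simp only [hyperplaneLift, LinearMap.coe_mk, AddHom.coe_mk, Fin.snoc_castSucc,
      Real.norm_eq_abs]
    nlinarith [mul_nonneg (mul_nonneg (Nat.cast_nonneg (α := ℝ) m) hM) hB]

/-- The second component of the affine rescaling of frequency space adapted to a cube with corner
`a` and side length `ρ`: the part that acts on the graph variables. -/
def shearedGraph {m n : ℕ} (P : Fin n → QuadraticForm ℝ (Fin (m + 1) → ℝ))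
    (v : EuclideanSpace ℝ (Fin m)) (b ρ : ℝ) (a : Fin m → ℝ) (t : Fin (m + 1) → ℝ)
    (η : Fin n → ℝ) (l : Fin n) : ℝ :=
  -- The bracket removes the first-order expansion of `P` at the hyperplane point over `a`, both
  -- vertically and along the hyperplane. The two terms after it restore the affine part of `P'` at
  -- the origin, so that the image is near the graph of `P'` itself, not of its homogeneous part.
  (ρ ^ 2)⁻¹ * (η l
      - (t (Fin.last m) - affineFun v b (Fin.init t))
        * polar (P l) (b • lastVector m + hyperplaneLift v a) (lastVector m)
      - P l (b • lastVector m + hyperplaneLift v a)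
      - polar (P l) (b • lastVector m + hyperplaneLift v a) (hyperplaneLift v (Fin.init t - a)))
    + P l (b • lastVector m)
    + ρ⁻¹ * polar (P l) (b • lastVector m) (hyperplaneLift v (Fin.init t - a))

/-- The affine rescaling of frequency space adapted to a cube with corner `a` and side length `ρ`
is invertible. -/
theorem exists_rescaling {m n : ℕ} (P : Fin n → QuadraticForm ℝ (Fin (m + 1) → ℝ))
    (v : EuclideanSpace ℝ (Fin m)) (b : ℝ) {ρ : ℝ} (hρ : ρ ≠ 0) (a : Fin m → ℝ) :
    ∃ (L : DecSpace (m + 1) n ≃L[ℝ] ℝ × DecSpace m n) (ξ₀ : DecSpace m n),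
      ∀ ξ, (∀ i, ((L ξ).2 - ξ₀) (Sum.inl i) = ρ⁻¹ * (ξ (Sum.inl i.castSucc) - a i)) ∧
        ∀ l, ((L ξ).2 - ξ₀) (Sum.inr l) =
          shearedGraph P v b ρ a (fun i => ξ (Sum.inl i)) (fun l => ξ (Sum.inr l)) l := by
  let G : DecSpace (m + 1) n → DecSpace m n := fun ξ => WithLp.toLp 2 (Sum.elim
    (fun i => ρ⁻¹ * (ξ (Sum.inl i.castSucc) - a i))
    (fun l => shearedGraph P v b ρ a (fun i => ξ (Sum.inl i)) (fun l => ξ (Sum.inr l)) l))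
  have hinit : ∀ ξ η : DecSpace (m + 1) n, (Fin.init fun i => ξ (Sum.inl i) + η (Sum.inl i)) =
      Fin.init (fun i => ξ (Sum.inl i)) + Fin.init fun i => η (Sum.inl i) := fun ξ η => rfl
  have hinits : ∀ (c : ℝ) (η : DecSpace (m + 1) n), (Fin.init fun i => c * η (Sum.inl i)) =
      c • Fin.init fun i => η (Sum.inl i) := fun c η => rfl
  have hinit0 : (Fin.init fun _ : Fin (m + 1) => (0 : ℝ)) = (0 : Fin m → ℝ) := rfl
  have haff0 : affineFun v b 0 = b := by simp [affineFun]
  have haffa : ∀ s t : Fin m → ℝ, affineFun v b (s + t) = affineFun v b s + affineFun v b t - b := by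
    intro s t
    simp only [affineFun, Pi.add_apply, mul_add, Finset.sum_add_distrib]
    ring
  have haffs : ∀ (c : ℝ) (t : Fin m → ℝ), affineFun v b (c • t) = c * affineFun v b t + b - c * b := by
    intro c t
    simp only [affineFun, Pi.smul_apply, smul_eq_mul, mul_left_comm _ c, ← Finset.mul_sum]
    ring
  -- The affine map `G` drops one dimension. Keeping the last base coordinate as slicing variable
  -- makes its linear part invertible, and the constant term becomes `ξ₀ = -G 0`.
  let Λ : DecSpace (m + 1) n →ₗ[ℝ] ℝ × DecSpace m n :=
    { toFun := fun ξ => (ξ (Sum.inl (Fin.last m)), G ξ - G 0)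
      map_add' := by
        intro ξ η
        refine Prod.ext rfl ?_
        ext i
        rcases i with i | l
        · simp only [G, PiLp.sub_apply, PiLp.add_apply, Prod.snd_add, Sum.elim_inl]
          simp
          ring
        · simp only [G, PiLp.sub_apply, Prod.snd_add, Sum.elim_inr, shearedGraph, hinit, haffa,
            hinit0, haff0, PiLp.add_apply, PiLp.zero_apply, _root_.map_sub, _root_.map_add,
            _root_.map_zero, polar_add_right, polar_sub_right, polar_zero_right]
          ring
      map_smul' := by
        intro c η
        refine Prod.ext rfl ?_
        ext i
        rcases i with i | l
        · simp only [G, PiLp.sub_apply, PiLp.smul_apply, Prod.smul_snd, Sum.elim_inl]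
          simp
          ring
        · simp only [G, PiLp.sub_apply, Prod.smul_snd, Sum.elim_inr, shearedGraph, hinits, haffs,
            hinit0, haff0, PiLp.smul_apply, PiLp.zero_apply, _root_.map_sub, _root_.map_smul,
            _root_.map_zero, polar_smul_right, polar_sub_right, polar_zero_right, smul_eq_mul,
            RingHom.id_apply]
          ring }
  have hinj : Function.Injective Λ := by
    rw [injective_iff_map_eq_zero]
    intro ξ hξ
    have h1 : ξ (Sum.inl (Fin.last m)) = 0 := congrArg Prod.fst hξ
    have h2 : G ξ - G 0 = 0 := congrArg Prod.snd hξ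
    have h3 : ∀ i : Fin m, ξ (Sum.inl i.castSucc) = 0 := by
      intro i
      have := congrArg (fun η : DecSpace m n => η (Sum.inl i)) h2
      simpa [G, ← mul_add, hρ] using this
    have h4 : (fun i => ξ (Sum.inl i)) = fun i : Fin (m + 1) => (0 : DecSpace (m + 1) n) (Sum.inl i) := by
      funext i
      refine Fin.lastCases ?_ (fun i => ?_) i
      · simpa using h1
      · simpa using h3 i
    ext i
    rcases i with i | l
    · exact congrFun h4 i
    · have := congrArg (fun η : DecSpace m n => η (Sum.inr l)) h2
      simp only [G, PiLp.sub_apply, Sum.elim_inr, shearedGraph, h4] at this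
      have h5 : (ρ ^ 2)⁻¹ * ξ (Sum.inr l) = 0 := by
        simp only [PiLp.zero_apply, h1] at this
        linarith
      simpa [hρ] using h5
  have hrank : Module.finrank ℝ (DecSpace (m + 1) n) = Module.finrank ℝ (ℝ × DecSpace m n) := by
    simp
    ring
  refine ⟨(LinearEquiv.ofInjectiveOfFinrankEq Λ hinj hrank).toContinuousLinearEquiv, -G 0,
    fun ξ => ?_⟩
  have hL : ((LinearEquiv.ofInjectiveOfFinrankEq Λ hinj hrank).toContinuousLinearEquiv ξ).2
      - -G 0 = G ξ := by
    change G ξ - G 0 - -G 0 = G ξ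
    abel
  rw [hL]
  exact ⟨fun i => rfl, fun l => rfl⟩

end Geometry

/-! ### Rescaled boxes near the hyperplane. -/

section Rescaling

open QuadraticMap

/-- Points of the graph of `Q` near a hyperplane `w₀ + ℓ`, after shearing and rescaling. -/
theorem sheared_quadraticForm_eq {X : Type*} [AddCommGroup X] [Module ℝ X]
    (Q : QuadraticForm ℝ X) {ρ : ℝ} (hρ : ρ ≠ 0) (δ r u : ℝ) (w₀ ℓa ℓτ e a s : X)
    (ht : a + δ • s = (w₀ + (ℓa + ρ • ℓτ)) + r • e) :
    (ρ ^ 2)⁻¹ * ((Q a + δ * polar Q a s + δ ^ 2 * u) - r * polar Q (w₀ + ℓa) e - Q (w₀ + ℓa)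
        - polar Q (w₀ + ℓa) (ρ • ℓτ)) + Q w₀ + ρ⁻¹ * polar Q w₀ (ρ • ℓτ)
      = Q (w₀ + ℓτ) + (ρ ^ 2)⁻¹ * (r * ρ * polar Q ℓτ e + r ^ 2 * Q e + δ ^ 2 * (u - Q s)) := by
  -- Second-order Taylor expansion is exact, so a box point is the graph point over `a + δ • s` up
  -- to `O(δ²)`; the corner of the small cube plays no further role.
  have h1 : Q a + δ * polar Q a s + δ ^ 2 * u = Q (a + δ • s) + δ ^ 2 * (u - Q s) := by
    rw [quadraticForm_add_smul]
    ring
  rw [h1, ht, quadraticForm_add_smul, ← add_assoc, quadraticForm_add_smul, polar_add_left Q _ (ρ • ℓτ),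
    polar_smul_left, polar_smul_right, polar_smul_right, QuadraticMap.map_add Q w₀ ℓτ]
  simp only [smul_eq_mul]
  field_simp
  ring

/-- If a box over a small cube lies near the hyperplane, then the rescaling adapted to a cube with
corner `a` and side length `ρ` maps it into the box attached to the restricted quadratic map over
the rescaled cube `σ`. -/
theorem exists_const_rescaled_mem_uncertaintyBox {m n : ℕ}
    (P : Fin n → QuadraticForm ℝ (Fin (m + 1) → ℝ)) (M : ℝ) : ∃ C₀ : ℝ, ∃ K : ℝ, 0 ≤ K ∧
    ∀ C, C₀ ≤ C → ∀ (v : EuclideanSpace ℝ (Fin m)) (b : ℝ), ‖v‖ ≤ M →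
    ∀ {k κ : ℕ} (j : DyadicIndex (m + 1) k) (σ : DyadicIndex m κ) (ρ ρ₁ : ℝ) (a : Fin m → ℝ),
    0 < ρ → ρ₁ = ρ * dyadicScale κ → dyadicScale k ^ 2 * (C + K * C ^ 2) ≤ ρ₁ ^ 2 →
    ∀ ξ ∈ uncertaintyBox C (quadraticMap P) j,
    (∀ i : Fin m, |ξ (Sum.inl i.castSucc) - (a i + ρ * dyadicCorner σ i)| ≤ 2 * ρ₁) →
    |ξ (Sum.inl (Fin.last m)) - affineFun v b (Fin.init fun i => ξ (Sum.inl i))| * ρ ≤ ρ₁ ^ 2 →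
    |ξ (Sum.inl (Fin.last m)) - affineFun v b (Fin.init fun i => ξ (Sum.inl i))| ≤ ρ₁ →
    ∀ ζ : DecSpace m n, (∀ i, ζ (Sum.inl i) = ρ⁻¹ * (ξ (Sum.inl i.castSucc) - a i)) →
      (∀ l, ζ (Sum.inr l) =
        shearedGraph P v b ρ a (fun i => ξ (Sum.inl i)) (fun l => ξ (Sum.inr l)) l) →
      ζ ∈ uncertaintyBox C (restrictToHyperplane P v b) σ := by
  obtain ⟨K, hK0, hK⟩ := exists_quadraticForm_bound P
  set N : ℝ := 1 + m * |M| with hN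
  have hN0 : 0 ≤ N := by positivity
  -- The terms bound `P (ℓ σ')`, the three errors divided by `ρ₁²`, and `|σ'| ≤ 2`. None involves
  -- `C`, because the `C`-dependent error is absorbed by the assumption on `ρ₁`; hence the same `C`
  -- serves for the source and target boxes.
  refine ⟨K * (N * 2) ^ 2 + K * (N * 3) + K + 1 + 2, K, hK0, ?_⟩
  intro C hC v b hv k κ j σ ρ ρ₁ a hρ hρ₁ hδ ξ hξ hbox hr1 hr2 ζ hζ1 hζ2
  obtain ⟨s, u, hs, hu, hξ1, hξ2⟩ := hξ
  have hv' : ‖v‖ ≤ |M| := hv.trans (le_abs_self M)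
  have hC2 : 2 ≤ C := by nlinarith [mul_nonneg hK0 (sq_nonneg (N * 2)), mul_nonneg hK0 hN0]
  have hC0 : 0 ≤ C := by linarith
  set δ := dyadicScale k
  set κ' := dyadicScale κ
  have hκ : 0 < κ' := by simp only [κ', dyadicScale]; positivity
  have hκ1 : κ' ≤ 1 := inv_le_one_of_one_le₀ (one_le_pow₀ one_le_two)
  have hρ₁0 : 0 < ρ₁ := hρ₁ ▸ mul_pos hρ hκ
  set t : Fin (m + 1) → ℝ := fun i => ξ (Sum.inl i) with htdef
  set r := ξ (Sum.inl (Fin.last m)) - affineFun v b (Fin.init t) with hrdef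
  set α := dyadicCorner σ
  set τ : Fin m → ℝ := fun i => ρ⁻¹ * (ξ (Sum.inl i.castSucc) - a i) with hτ
  set σ' : Fin m → ℝ := fun i => κ'⁻¹ * (τ i - α i) with hσ'
  have hτσ : ∀ i, τ i = α i + κ' * σ' i := by
    intro i
    simp only [hσ']
    field_simp
    ring
  have hσ2 : ∀ i, |σ' i| ≤ 2 := by
    intro i
    have h1 : σ' i = ρ₁⁻¹ * (ξ (Sum.inl i.castSucc) - (a i + ρ * α i)) := by
      simp only [hσ', hτ, hρ₁]
      field_simp
      ring
    rw [h1, abs_mul, abs_of_pos (inv_pos.2 hρ₁0), inv_mul_le_iff₀ hρ₁0]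
    linarith [hbox i]
  have hα : ∀ i, 0 ≤ α i ∧ α i ≤ 1 := by
    intro i
    have h1 : ((σ i : ℕ) : ℝ) ≤ 2 ^ κ := by exact_mod_cast (σ i).2.le
    refine ⟨mul_nonneg hκ.le (Nat.cast_nonneg _), ?_⟩
    have : (0 : ℝ) < 2 ^ κ := by positivity
    simp only [α, dyadicCorner, dyadicScale]
    rw [inv_mul_le_iff₀ this]
    linarith
  have hτ3 : ∀ i, |τ i| ≤ 3 := by
    intro i
    have h1 := hα i
    have h2 := abs_le.1 (hσ2 i)
    rw [hτσ i, abs_le]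
    constructor <;> nlinarith
  have hinit : Fin.init t = a + ρ • τ := by
    funext i
    simp only [Fin.init, htdef, hτ, Pi.add_apply, Pi.smul_apply, smul_eq_mul]
    field_simp
    ring
  set ℓ := hyperplaneLift v
  set e := lastVector m
  have hte : t = (b • e + (ℓ a + ρ • ℓ τ)) + r • e := by
    have := eq_lift_add_smul_lastVector v b t
    rw [hinit, _root_.map_add, _root_.map_smul] at this
    rw [← hinit] at this
    exact this
  have htj : dyadicCorner j + δ • s = t := by
    funext i
    simp [htdef, hξ1 i, δ]
  have hq : ∀ l, fderiv ℝ (quadraticMap P) (dyadicCorner j) s l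
      = polar (P l) (dyadicCorner j) s := by
    intro l
    have := fderiv_quadraticForm_comp P LinearMap.id 0 (dyadicCorner j) s l
    simpa [quadraticMap] using! this
  have hq' : ∀ l, fderiv ℝ (restrictToHyperplane P v b) α σ' l
      = polar (P l) (b • e + ℓ α) (ℓ σ') := by
    intro l
    rw [restrictToHyperplane_eq]
    exact fderiv_quadraticForm_comp P ℓ (b • e) α σ' l
  have hlift : ∀ l, ζ (Sum.inr l) = P l (b • e + ℓ τ) + (ρ ^ 2)⁻¹ *
      (r * ρ * polar (P l) (ℓ τ) e + r ^ 2 * P l e + δ ^ 2 * (u l - P l s)) := by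
    intro l
    rw [← sheared_quadraticForm_eq (P l) hρ.ne' δ r (u l) (b • e) (ℓ a) (ℓ τ) e
      (dyadicCorner j) s (htj.trans hte), hζ2 l, shearedGraph, hinit, add_sub_cancel_left,
      _root_.map_smul, hξ2 l, hq l]
    simp only [← hinit]
    rfl
  -- `σ'` is the position relative to the corner of `σ` in units of its side. The second witness
  -- adds the quadratic remainder of `P'` to the errors, using `ρ⁻² = κ'² ρ₁⁻²`.
  refine ⟨σ', fun l => P l (ℓ σ') + (ρ₁ ^ 2)⁻¹ *
      (r * ρ * polar (P l) (ℓ τ) e + r ^ 2 * P l e + δ ^ 2 * (u l - P l s)),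
    fun i => (hσ2 i).trans hC2, fun l => ?_, fun i => (hζ1 i).trans (hτσ i), fun l => ?_⟩
  · have he : ‖e‖ ≤ 1 := by
      refine (pi_norm_le_iff_of_nonneg zero_le_one).2 fun i => ?_
      refine Fin.lastCases ?_ (fun i => ?_) i <;> simp [e, lastVector]
    have b1 : |P l (ℓ σ')| ≤ K * (N * 2) ^ 2 :=
      (hK l _).1.trans (by gcongr; exact norm_hyperplaneLift_le hv' (by norm_num) hσ2)
    have b2 : |polar (P l) (ℓ τ) e| ≤ K * (N * 3) := by
      refine ((hK l _).2 e).trans ?_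
      have h1 := norm_hyperplaneLift_le hv' (by norm_num) hτ3
      calc K * ‖ℓ τ‖ * ‖e‖ ≤ K * (N * 3) * 1 := by gcongr
        _ = _ := mul_one _
    have b3 : |P l e| ≤ K := by
      refine (hK l e).1.trans ?_
      calc K * ‖e‖ ^ 2 ≤ K * 1 ^ 2 := by gcongr
        _ = K := by ring
    have b4 : |u l - P l s| ≤ C + K * C ^ 2 := by
      have h1 : ‖s‖ ≤ C := (pi_norm_le_iff_of_nonneg hC0).2 hs
      have h2 : |P l s| ≤ K * C ^ 2 := (hK l s).1.trans (by gcongr)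
      exact (abs_sub _ _).trans (add_le_add (hu l) h2)
    have c1 : |r * ρ * polar (P l) (ℓ τ) e| ≤ ρ₁ ^ 2 * (K * (N * 3)) := by
      rw [abs_mul, abs_mul, abs_of_pos hρ]
      gcongr
    have c2 : |r ^ 2 * P l e| ≤ ρ₁ ^ 2 * K := by
      rw [abs_mul, abs_pow]
      gcongr
    have c3 : |δ ^ 2 * (u l - P l s)| ≤ ρ₁ ^ 2 := by
      rw [abs_mul, abs_of_nonneg (sq_nonneg δ)]
      exact (mul_le_mul_of_nonneg_left b4 (sq_nonneg δ)).trans hδ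
    have c4 : |(ρ₁ ^ 2)⁻¹ * (r * ρ * polar (P l) (ℓ τ) e + r ^ 2 * P l e + δ ^ 2 * (u l - P l s))|
        ≤ K * (N * 3) + K + 1 := by
      rw [abs_mul, abs_of_pos (by positivity : 0 < (ρ₁ ^ 2)⁻¹), inv_mul_le_iff₀ (by positivity)]
      refine (abs_add_three _ _ _).trans ?_
      linarith
    refine (abs_add_le _ _).trans ?_
    linarith
  · have hℓ : ℓ τ = ℓ α + κ' • ℓ σ' := by
      rw [← _root_.map_smul, ← _root_.map_add]
      congr 1
      funext i
      simp [hτσ i]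
    rw [hlift l, hq', restrictToHyperplane_eq]
    change _ = P l (b • e + ℓ α) + κ' * _ + κ' ^ 2 * _
    rw [hℓ, ← add_assoc, quadraticForm_add_smul, hρ₁]
    field_simp
    ring

end Rescaling

/-! ### Dyadic scales and columns of cubes. -/

section Columns

theorem dyadicScale_pos (k : ℕ) : 0 < dyadicScale k := by
  unfold dyadicScale
  positivity

theorem dyadicScale_add (k l : ℕ) : dyadicScale (k + l) = dyadicScale k * dyadicScale l := by
  unfold dyadicScale
  rw [pow_add, mul_inv]

theorem dyadicScale_mul_two_pow (k : ℕ) : dyadicScale k * 2 ^ k = 1 := by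
  unfold dyadicScale
  exact inv_mul_cancel₀ (by positivity)

theorem dyadicScale_le_of_le {k l : ℕ} (h : k ≤ l) : dyadicScale l ≤ dyadicScale k := by
  unfold dyadicScale
  gcongr
  norm_num

theorem dyadicScale_rpow_le {k q : ℕ} (h : k ≤ q) (x : ℝ) :
    dyadicScale k ^ x ≤ 2 ^ (q * |x|) := by
  have : dyadicScale k = (2 : ℝ) ^ (-(k : ℝ)) := by
    rw [dyadicScale, Real.rpow_neg zero_le_two, Real.rpow_natCast]
  rw [this, ← Real.rpow_mul zero_le_two]
  refine Real.rpow_le_rpow_of_exponent_le one_le_two ?_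
  have h1 : (k : ℝ) ≤ q := by exact_mod_cast h
  have h2 : -(k : ℝ) * x ≤ k * |x| := by
    rw [neg_mul, ← mul_neg]
    exact mul_le_mul_of_nonneg_left (neg_le_abs x) (Nat.cast_nonneg k)
  exact h2.trans (mul_le_mul_of_nonneg_right h1 (abs_nonneg x))

/-- The cubes in `S` that lie over the cube with index `θ` and side length `2^{-κ}` in the first
`m` variables. -/
def columnOver {m k : ℕ} (S : Finset (DyadicIndex (m + 1) k)) (κ : ℕ) (θ : Fin m → ℕ) :
    Finset (DyadicIndex (m + 1) k) :=
  S.filter fun j => ∀ i : Fin m, (j i.castSucc : ℕ) / 2 ^ (k - κ) = θ i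

/-- The index of a subcube of the cube with index `θ`. -/
def childIndex {m μ : ℕ} (θ : Fin m → ℕ) (σ : DyadicIndex m μ) : Fin m → ℕ :=
  fun i => θ i * 2 ^ μ + σ i

/-- Division by `2 ^ (k - κ)` reads the leading binary digits of an index. The next `μ` digits
select the subcube, so the subcolumns partition the column. -/
theorem sum_columnOver {m k κ μ : ℕ} (h : κ + μ ≤ k) (S : Finset (DyadicIndex (m + 1) k))
    (θ : Fin m → ℕ) {E : Type*} [AddCommMonoid E] (f : DyadicIndex (m + 1) k → E) :
    ∑ j ∈ columnOver S κ θ, f j =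
      ∑ σ : DyadicIndex m μ, ∑ j ∈ columnOver S (κ + μ) (childIndex θ σ), f j := by
  rw [← Finset.sum_fiberwise (columnOver S κ θ) (fun j (i : Fin m) =>
    (⟨(j i.castSucc : ℕ) / 2 ^ (k - (κ + μ)) % 2 ^ μ, Nat.mod_lt _ (by positivity)⟩ :
      Fin (2 ^ μ)))]
  refine Finset.sum_congr rfl fun σ _ => Finset.sum_congr ?_ fun _ _ => rfl
  ext j
  have hpow : 2 ^ (k - κ) = 2 ^ (k - (κ + μ)) * 2 ^ μ := by
    rw [← pow_add]
    congr 1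
    omega
  rw [columnOver, columnOver, Finset.mem_filter, Finset.mem_filter, Finset.mem_filter, and_assoc]
  refine and_congr_right fun _ => ?_
  simp only [funext_iff, ← forall_and, Fin.ext_iff, childIndex, hpow, ← Nat.div_div_eq_div_mul]
  refine forall_congr' fun i => ?_
  have hσ := (σ i).2
  constructor
  · rintro ⟨h1, h2⟩
    rw [← h1, ← h2, mul_comm]
    exact (Nat.div_add_mod _ _).symm
  · intro h1
    rw [h1]
    refine ⟨?_, ?_⟩
    · rw [mul_comm, Nat.mul_add_div (by positivity), Nat.div_eq_of_lt hσ, add_zero]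
    · rw [mul_comm, Nat.mul_add_mod, Nat.mod_eq_of_lt hσ]

theorem isVanishingOn_fourier_sum {V ι : Type*} [NormedAddCommGroup V] [InnerProductSpace ℝ V]
    [FiniteDimensional ℝ V] [MeasurableSpace V] [BorelSpace V] {p : ℝ≥0∞} [Fact (1 ≤ p)]
    (s : Finset ι) (f : ι → Lp ℂ p (volume : Measure V)) {U : Set V}
    (hf : ∀ i ∈ s, Distribution.IsVanishingOn
      (𝓕 (Lp.toTemperedDistribution (f i)) : 𝓢'(V, ℂ)) U) :
    Distribution.IsVanishingOn
      (𝓕 (Lp.toTemperedDistribution (∑ i ∈ s, f i)) : 𝓢'(V, ℂ)) U := by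
  intro φ hφ
  have h1 : ∀ g : Lp ℂ p (volume : Measure V), (𝓕 (Lp.toTemperedDistribution g) : 𝓢'(V, ℂ)) φ =
      (PointwiseConvergenceCLM.evalCLM (RingHom.id ℂ) ℂ (𝓕 φ) ∘L
        Lp.toTemperedDistributionCLM ℂ (volume : Measure V) p) g := fun _ => rfl
  rw [h1, map_sum]
  exact Finset.sum_eq_zero fun i hi => (h1 (f i)).symm.trans (hf i hi φ hφ)

/-- The trivial decoupling inequality. -/
theorem norm_sum_le_card_mul {E ι : Type*} [SeminormedAddCommGroup E] (s : Finset ι) (f : ι → E)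
    {p N : ℝ} (hp : 0 < p) (hN : (s.card : ℝ) ≤ N) :
    ‖∑ i ∈ s, f i‖ ≤ N * (∑ i ∈ s, ‖f i‖ ^ p) ^ (1 / p) := by
  have key : ∀ j ∈ s, ‖f j‖ ≤ (∑ i ∈ s, ‖f i‖ ^ p) ^ (1 / p) := by
    intro j hj
    have h1 : ‖f j‖ ^ p ≤ ∑ i ∈ s, ‖f i‖ ^ p :=
      Finset.single_le_sum (f := fun i => ‖f i‖ ^ p) (fun i _ => by positivity) hj
    calc ‖f j‖ = (‖f j‖ ^ p) ^ (1 / p) := by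
          rw [← Real.rpow_mul (norm_nonneg _), mul_one_div_cancel hp.ne', Real.rpow_one]
      _ ≤ _ := Real.rpow_le_rpow (by positivity) h1 (by positivity)
  refine (norm_sum_le_of_le s key).trans ?_
  rw [Finset.sum_const, nsmul_eq_mul]
  exact mul_le_mul_of_nonneg_right hN
    (Real.rpow_nonneg (Finset.sum_nonneg fun i _ => by positivity) _)

/-- The cubes near a hyperplane lie in a neighborhood of width comparable to their side length. -/
theorem abs_sub_affineFun_le_of_mem_cubesNear {m k : ℕ} {M c C : ℝ} (hc : 0 < c)
    {v : EuclideanSpace ℝ (Fin m)} {b : ℝ} (hv : ‖v‖ ≤ M)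
    {j : DyadicIndex (m + 1) k} (hj : j ∈ cubesNear c (graphHyperplane v b) k)
    {t : Fin (m + 1) → ℝ} (ht : ∀ i, |t i - dyadicCorner j i| ≤ C * dyadicScale k) :
    |t (Fin.last m) - affineFun v b (Fin.init t)| ≤
      (1 + m * M) * (C + 1 + c) * dyadicScale k := by
  have hj' : (dilatedCube c j ∩ graphHyperplane v b).Nonempty := by
    simpa [cubesNear] using hj
  obtain ⟨h, hh1, hh2⟩ := hj'
  have hδ := dyadicScale_pos k
  have hth : ∀ i, |t i - h i| ≤ (C + 1 + c) * dyadicScale k := by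
    intro i
    have h1 := abs_le.1 (ht i)
    have h2 := abs_le.1 (hh1 i)
    have h3 : 0 < c * dyadicScale k := mul_pos hc hδ
    rw [abs_le]
    constructor <;> linarith
  have hsum := abs_sum_mul_le (t := fun i : Fin m => t i.castSucc - h i.castSucc) hv
    fun i => hth i.castSucc
  have hlast : h (Fin.last m) = affineFun v b (Fin.init h) := hh2
  have heq : t (Fin.last m) - affineFun v b (Fin.init t) =
      (t (Fin.last m) - h (Fin.last m)) - ∑ i, v i * (t i.castSucc - h i.castSucc) := by
    rw [hlast]
    simp only [affineFun, Fin.init, mul_sub, Finset.sum_sub_distrib]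
    ring
  rw [heq]
  refine (abs_sub _ _).trans ?_
  linarith [hth (Fin.last m)]

/-- The number of cubes near a hyperplane over a cube of comparable side length is bounded. -/
theorem card_columnOver_le {m k κ q N : ℕ} {M R : ℝ} {v : EuclideanSpace ℝ (Fin m)} {b : ℝ}
    (hv : ‖v‖ ≤ M) (hk : k ≤ κ + q) (S : Finset (DyadicIndex (m + 1) k))
    (hS : ∀ j ∈ S, |dyadicCorner j (Fin.last m) - affineFun v b (Fin.init (dyadicCorner j))|
      ≤ R * dyadicScale k)
    (hN : 2 * R + m * M * 2 ^ q ≤ N) (hN' : 2 ^ q ≤ N) (θ : Fin m → ℕ) :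
    (columnOver S κ θ).card ≤ (2 * N + 1) ^ (m + 1) := by
  rcases (columnOver S κ θ).eq_empty_or_nonempty with h0 | ⟨j₀, hj₀⟩
  · simp [h0]
  have hδ := dyadicScale_pos k
  have hpow : 2 ^ (k - κ) ≤ 2 ^ q := Nat.pow_le_pow_right two_pos (by omega)
  have hclose : ∀ j ∈ columnOver S κ θ, ∀ i : Fin m,
      |((j i.castSucc : ℕ) : ℝ) - (j₀ i.castSucc : ℕ)| ≤ 2 ^ q := by
    intro j hj i
    have h1 := (Finset.mem_filter.1 hj).2 i
    have h2 := (Finset.mem_filter.1 hj₀).2 i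
    have hp : 0 < 2 ^ (k - κ) := by positivity
    have e1 := Nat.div_add_mod (j i.castSucc : ℕ) (2 ^ (k - κ))
    have e2 := Nat.div_add_mod (j₀ i.castSucc : ℕ) (2 ^ (k - κ))
    have l1 := Nat.mod_lt (j i.castSucc : ℕ) hp
    have l2 := Nat.mod_lt (j₀ i.castSucc : ℕ) hp
    rw [h1] at e1
    rw [h2] at e2
    have a1 : (j i.castSucc : ℕ) ≤ (j₀ i.castSucc : ℕ) + 2 ^ q := by omega
    have a2 : (j₀ i.castSucc : ℕ) ≤ (j i.castSucc : ℕ) + 2 ^ q := by omega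
    have b1 : ((j i.castSucc : ℕ) : ℝ) ≤ (j₀ i.castSucc : ℕ) + 2 ^ q := by exact_mod_cast a1
    have b2 : ((j₀ i.castSucc : ℕ) : ℝ) ≤ (j i.castSucc : ℕ) + 2 ^ q := by exact_mod_cast a2
    rw [abs_le]
    constructor <;> linarith
  -- The last coordinate is controlled because both corners are within `R δ` of a hyperplane of
  -- slope at most `M`, over base points that are already close.
  have hall : ∀ j ∈ columnOver S κ θ, ∀ i, |((j i : ℕ) : ℝ) - (j₀ i : ℕ)| ≤ N := by
    intro j hj i
    refine Fin.lastCases ?_ (fun i => ?_) i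
    · have h1 := hS j (Finset.mem_filter.1 hj).1
      have h2 := hS j₀ (Finset.mem_filter.1 hj₀).1
      have h3 := abs_sum_mul_le (t := fun i : Fin m =>
        dyadicCorner j i.castSucc - dyadicCorner j₀ i.castSucc) (B := dyadicScale k * 2 ^ q) hv
        (fun i => by
          simp only [dyadicCorner, ← mul_sub]
          rw [abs_mul, abs_of_pos hδ]
          exact mul_le_mul_of_nonneg_left (hclose j hj i) hδ.le)
      simp only [affineFun, Fin.init, mul_sub, Finset.sum_sub_distrib] at h1 h2 h3
      have e1 : dyadicCorner j (Fin.last m) = dyadicScale k * (j (Fin.last m) : ℕ) := rfl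
      have e2 : dyadicCorner j₀ (Fin.last m) = dyadicScale k * (j₀ (Fin.last m) : ℕ) := rfl
      rw [e1] at h1
      rw [e2] at h2
      have h5 : dyadicScale k * |((j (Fin.last m) : ℕ) : ℝ) - (j₀ (Fin.last m) : ℕ)| ≤
          dyadicScale k * (2 * R + m * M * 2 ^ q) := by
        rw [← abs_of_pos hδ, ← abs_mul, abs_of_pos hδ]
        rw [abs_le] at h1 h2 h3 ⊢
        constructor <;> linarith
      exact (le_of_mul_le_mul_left h5 hδ).trans hN
    · exact (hclose j hj i).trans (by exact_mod_cast hN')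
  have hsub : columnOver S κ θ ⊆ Fintype.piFinset fun i =>
      Finset.univ.filter fun x : Fin (2 ^ k) => |((x : ℕ) : ℝ) - (j₀ i : ℕ)| ≤ N := by
    intro j hj
    simp only [Fintype.mem_piFinset, Finset.mem_filter, Finset.mem_univ, true_and]
    exact hall j hj
  refine (Finset.card_le_card hsub).trans ?_
  rw [Fintype.card_piFinset]
  refine (Finset.prod_le_pow_card _ _ (2 * N + 1) fun i _ => ?_).trans (by simp)
  have hinj : (Finset.univ.filter fun x : Fin (2 ^ k) => |((x : ℕ) : ℝ) - (j₀ i : ℕ)| ≤ N).card ≤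
      (Finset.Icc ((j₀ i : ℕ) - N) ((j₀ i : ℕ) + N)).card := by
    refine Finset.card_le_card_of_injOn (fun x => (x : ℕ)) (fun x hx => ?_)
      (fun x _ y _ h => Fin.ext h)
    have h1 : |((x : ℕ) : ℝ) - (j₀ i : ℕ)| ≤ N := by simpa using hx
    rw [abs_le] at h1
    have a1 : ((x : ℕ) : ℝ) ≤ ((j₀ i : ℕ) + N : ℕ) := by push_cast; linarith
    have a2 : ((j₀ i : ℕ) : ℝ) ≤ ((x : ℕ) + N : ℕ) := by push_cast; linarith
    have a3 : (x : ℕ) ≤ (j₀ i : ℕ) + N := by exact_mod_cast a1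
    have a4 : (j₀ i : ℕ) ≤ (x : ℕ) + N := by exact_mod_cast a2
    simp only [Finset.coe_Icc, Set.mem_Icc]
    omega
  refine hinj.trans ?_
  rw [Nat.card_Icc]
  omega

end Columns

/-! ### One decoupling step and its iteration. -/

section Iteration

/-- Decoupling of a column of cubes near a hyperplane into smaller columns. -/
theorem exists_const_column_decoupling {m n : ℕ}
    (P : Fin n → QuadraticForm ℝ (Fin (m + 1) → ℝ)) (M : ℝ) : ∃ C₀ : ℝ, ∃ K : ℝ, 0 ≤ K ∧
    ∀ C, C₀ ≤ C → 0 ≤ C → ∀ (v : EuclideanSpace ℝ (Fin m)) (b : ℝ), ‖v‖ ≤ M →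
    ∀ (p : ℝ≥0∞) [Fact (1 ≤ p)], p ≠ ∞ → ∀ {k k₀ q κ μ : ℕ} {R : ℝ}, k₀ + q = k →
    κ + 2 * μ ≤ k₀ → 1 + C + K * C ^ 2 ≤ R → R ≤ 2 ^ q →
    ∀ S : Finset (DyadicIndex (m + 1) k),
    (∀ j ∈ S, ∀ t : Fin (m + 1) → ℝ, (∀ i, |t i - dyadicCorner j i| ≤ C * dyadicScale k) →
      |t (Fin.last m) - affineFun v b (Fin.init t)| ≤ R * dyadicScale k) →
    ∀ D : ℝ, 0 ≤ D → DecouplingInequality p C (restrictToHyperplane P v b) μ Finset.univ D →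
    ∀ (θ : Fin m → ℕ) (f : DyadicIndex (m + 1) k → Lp ℂ p (volume : Measure (DecSpace (m + 1) n))),
    (∀ j ∈ S, HasFourierSupportIn (f j) (uncertaintyBox C (quadraticMap P) j)) →
    ‖∑ j ∈ columnOver S κ θ, f j‖ ≤ D * (∑ σ : DyadicIndex m μ,
      ‖∑ j ∈ columnOver S (κ + μ) (childIndex θ σ), f j‖ ^ p.toReal) ^ (1 / p.toReal) := by
  obtain ⟨C₀, K, hK0, hgeo⟩ := exists_const_rescaled_mem_uncertaintyBox P M
  refine ⟨C₀, K, hK0, ?_⟩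
  intro C hC hC0 v b hv p _ hp k k₀ q κ μ R hk hκ hCR hRq S hS D hD hdec θ f hf
  set δ := dyadicScale k
  set ρ := dyadicScale κ
  set ρ₁ := dyadicScale (κ + μ) with hρ₁
  have hδ : 0 < δ := dyadicScale_pos k
  have hρ : 0 < ρ := dyadicScale_pos κ
  have hρ₁0 : 0 < ρ₁ := dyadicScale_pos _
  have hKC : 0 ≤ K * C ^ 2 := by positivity
  have hR1 : 1 ≤ R := by linarith
  -- The slightly larger scale `2^{-k₀}` absorbs `R`, so that `κ + 2 * μ ≤ k₀` becomes exactly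
  -- `2^{-k₀} ρ ≤ ρ₁²`.
  have hδR : R * δ ≤ dyadicScale k₀ := by
    have h1 : δ = dyadicScale k₀ * dyadicScale q := by rw [← dyadicScale_add, hk]
    calc R * δ ≤ 2 ^ q * δ := by gcongr
      _ = dyadicScale k₀ * (dyadicScale q * 2 ^ q) := by rw [h1]; ring
      _ = dyadicScale k₀ := by rw [dyadicScale_mul_two_pow, mul_one]
  have hRρ₁ : R * δ ≤ ρ₁ := hδR.trans (dyadicScale_le_of_le (by omega))
  have hRρ : R * δ * ρ ≤ ρ₁ ^ 2 := by
    calc R * δ * ρ ≤ dyadicScale k₀ * ρ := by gcongr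
      _ ≤ dyadicScale (κ + 2 * μ) * ρ := by gcongr; exact dyadicScale_le_of_le hκ
      _ = ρ₁ ^ 2 := by
        rw [← dyadicScale_add, sq, ← dyadicScale_add]
        congr 1
        omega
  have hδ2 : δ ^ 2 * (C + K * C ^ 2) ≤ ρ₁ ^ 2 := by
    calc δ ^ 2 * (C + K * C ^ 2) ≤ δ ^ 2 * R ^ 2 := by
          gcongr
          nlinarith
      _ = (R * δ) ^ 2 := by ring
      _ ≤ ρ₁ ^ 2 := by gcongr
  obtain ⟨L, ξ₀, hL⟩ := exists_rescaling P v b hρ.ne' (fun i => ρ * (θ i : ℝ))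
  rw [sum_columnOver (by omega : κ + μ ≤ k)]
  -- Each subcolumn sum counts as one function, with frequencies in the union of its boxes.
  refine decoupling_of_slices hp L ξ₀ Finset.univ
    (U := fun σ => ⋃ j ∈ columnOver S (κ + μ) (childIndex θ σ), uncertaintyBox C (quadraticMap P) j)
    (U' := fun σ => uncertaintyBox C (restrictToHyperplane P v b) σ) ?_ hD hdec _ ?_
  · intro σ _ ξ hξ
    simp only [Set.mem_iUnion] at hξ
    obtain ⟨j, hj, hξj⟩ := hξ
    obtain ⟨hjS, hjθ⟩ := Finset.mem_filter.1 hj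
    have hclose : ∀ i, |ξ (Sum.inl i) - dyadicCorner j i| ≤ C * δ := by
      obtain ⟨s, u, hs, -, hξ1, -⟩ := hξj
      intro i
      rw [hξ1 i, add_sub_cancel_left, abs_mul, abs_of_pos hδ, mul_comm]
      gcongr
      exact hs i
    have hr := hS j hjS (fun i => ξ (Sum.inl i)) hclose
    refine hgeo C hC v b hv j σ ρ ρ₁ (fun i => ρ * (θ i : ℝ)) hρ (dyadicScale_add κ μ) hδ2 ξ hξj
      (fun i => ?_) ((mul_le_mul_of_nonneg_right hr hρ.le).trans hRρ) (hr.trans hRρ₁) _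
      (hL ξ).1 (hL ξ).2
    have e1 := Nat.div_add_mod (j i.castSucc : ℕ) (2 ^ (k - (κ + μ)))
    have l1 := (Nat.mod_lt (j i.castSucc : ℕ) (by positivity : 0 < 2 ^ (k - (κ + μ)))).le
    rw [hjθ i] at e1
    set w := (j i.castSucc : ℕ) % 2 ^ (k - (κ + μ))
    have e2 : ((j i.castSucc : ℕ) : ℝ) = 2 ^ (k - (κ + μ)) * (θ i * 2 ^ μ + (σ i : ℕ)) + w := by
      rw [← e1]
      push_cast [childIndex]
      ring
    have l2 : (w : ℝ) ≤ 2 ^ (k - (κ + μ)) := by exact_mod_cast l1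
    have hδρ : δ * 2 ^ (k - (κ + μ)) = ρ₁ := by
      have h1 : δ = ρ₁ * dyadicScale (k - (κ + μ)) := by
        rw [hρ₁, ← dyadicScale_add]
        change dyadicScale k = _
        congr 1
        omega
      rw [h1, mul_assoc, dyadicScale_mul_two_pow, mul_one]
    have hρρ : ρ₁ * 2 ^ μ = ρ := by
      rw [hρ₁, dyadicScale_add, mul_assoc, dyadicScale_mul_two_pow, mul_one]
    have e3 : dyadicCorner j i.castSucc - (ρ * (θ i : ℝ) + ρ * dyadicCorner σ i) = δ * w := by
      have h1 : dyadicCorner j i.castSucc = δ * (j i.castSucc : ℕ) := rfl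
      have h2 : ρ * dyadicCorner σ i = ρ₁ * (σ i : ℕ) := by
        rw [hρ₁, dyadicScale_add, mul_assoc]
        rfl
      rw [h1, h2, e2, ← hρρ, mul_add, ← mul_assoc, hδρ]
      ring
    have h4 := abs_le.1 (hclose i.castSucc)
    have h5 : 0 ≤ δ * w := by positivity
    have h6 : δ * w ≤ ρ₁ := by
      rw [← hδρ]
      gcongr
    have h7 : C * δ ≤ ρ₁ := (mul_le_mul_of_nonneg_right (by linarith) hδ.le).trans hRρ₁
    rw [abs_le]
    constructor <;> linarith
  · intro σ _
    refine isVanishingOn_fourier_sum _ _ fun j hj => ?_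
    exact (hf j (Finset.mem_filter.1 hj).1).mono
      (Set.compl_subset_compl.2 (Set.subset_biUnion_of_mem (u := fun j =>
        uncertaintyBox C (quadraticMap P) j) hj))

/-- Iterating a decoupling inequality that halves the distance `g` to the final scale (on a
logarithmic scale) loses a constant only `O(log g)` many times. -/
theorem norm_sum_columnOver_le {E : Type*} [NormedAddCommGroup E] {m k k₀ : ℕ}
    (S : Finset (DyadicIndex (m + 1) k)) (f : DyadicIndex (m + 1) k → E) {p A B Λ : ℝ} (hp : 0 < p)
    (hA : 1 ≤ A) (hB : 0 ≤ B) (hk : k₀ ≤ k)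
    (hbase : ∀ κ θ, k₀ ≤ κ + 1 → ‖∑ j ∈ columnOver S κ θ, f j‖
      ≤ B * dyadicScale (k₀ - κ) ^ (-Λ) * (∑ j ∈ columnOver S κ θ, ‖f j‖ ^ p) ^ (1 / p))
    (hstep : ∀ κ μ θ, κ + 2 * μ ≤ k₀ → 1 ≤ μ → ‖∑ j ∈ columnOver S κ θ, f j‖
      ≤ A * dyadicScale μ ^ (-Λ) * (∑ σ : DyadicIndex m μ,
        ‖∑ j ∈ columnOver S (κ + μ) (childIndex θ σ), f j‖ ^ p) ^ (1 / p)) (g : ℕ) :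
    ∀ κ θ, κ + g = k₀ → ‖∑ j ∈ columnOver S κ θ, f j‖
      ≤ A ^ Nat.clog 2 g * B * dyadicScale g ^ (-Λ)
        * (∑ j ∈ columnOver S κ θ, ‖f j‖ ^ p) ^ (1 / p) := by
  induction g using Nat.strong_induction_on with
  | _ g ih =>
    intro κ θ hg
    have hA0 : 0 ≤ A := zero_le_one.trans hA
    rcases Nat.lt_or_ge g 2 with h | h
    · have := hbase κ θ (by omega)
      rw [Nat.clog_of_right_le_one (by omega), pow_zero, one_mul]
      rwa [show k₀ - κ = g by omega] at this
    -- The largest `μ` with `κ + 2 * μ ≤ k₀`. The remaining gap `g'` is `⌈g/2⌉`, written as in the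
    -- recursion for `Nat.clog`.
    · set μ := g / 2
      set g' := (g + 2 - 1) / 2 with hg'
      have hsum : μ + g' = g := by omega
      have hpos : ∀ l, 0 ≤ dyadicScale l ^ (-Λ) := fun l =>
        Real.rpow_nonneg (dyadicScale_pos l).le _
      set Q := A ^ Nat.clog 2 g' * B * dyadicScale g' ^ (-Λ) with hQ
      have hQ0 : 0 ≤ Q := mul_nonneg (by positivity) (hpos _)
      have h0 : ∀ s : Finset (DyadicIndex (m + 1) k), 0 ≤ ∑ j ∈ s, ‖f j‖ ^ p :=
        fun s => Finset.sum_nonneg fun j _ => by positivity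
      have h1 : ∀ σ : DyadicIndex m μ,
          ‖∑ j ∈ columnOver S (κ + μ) (childIndex θ σ), f j‖ ^ p ≤
          Q ^ p * ∑ j ∈ columnOver S (κ + μ) (childIndex θ σ), ‖f j‖ ^ p := by
        intro σ
        have h2 := Real.rpow_le_rpow (norm_nonneg _)
          (ih g' (by omega) (κ + μ) (childIndex θ σ) (by omega)) hp.le
        rwa [Real.mul_rpow hQ0 (Real.rpow_nonneg (h0 _) _), ← Real.rpow_mul (h0 _),
          one_div_mul_cancel hp.ne', Real.rpow_one] at h2
      have h3 := Finset.sum_le_sum fun σ (_ : σ ∈ Finset.univ) => h1 σ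
      rw [← Finset.mul_sum, ← sum_columnOver (by omega : κ + μ ≤ k)] at h3
      have h4 := Real.rpow_le_rpow (Finset.sum_nonneg fun σ _ => by positivity) h3
        (by positivity : 0 ≤ 1 / p)
      rw [Real.mul_rpow (by positivity) (h0 _), ← Real.rpow_mul hQ0, mul_one_div_cancel hp.ne',
        Real.rpow_one] at h4
      refine (hstep κ μ θ (by omega) (by omega)).trans
        ((mul_le_mul_of_nonneg_left h4 (mul_nonneg hA0 (hpos _))).trans_eq ?_)
      -- The scale factors multiply exactly, so a step costs only one factor `A`.
      rw [hQ, Nat.clog_of_two_le one_lt_two h, ← hg', pow_succ, ← hsum, dyadicScale_add,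
        Real.mul_rpow (dyadicScale_pos _).le (dyadicScale_pos _).le]
      ring

/-- Source of the logarithmic loss: `2 ^ clog k ≤ 2k`, raised to the power `log₂ A`, with `k = |log
δ| / log 2`. -/
theorem pow_clog_le {A : ℝ} (hA : 1 ≤ A) {g k : ℕ} (hk : 1 ≤ k) (hg : g ≤ k) :
    A ^ Nat.clog 2 g ≤ (2 / Real.log 2 * |Real.log (dyadicScale k)|) ^ Real.logb 2 A := by
  have hlog : 0 < Real.log 2 := Real.log_pos one_lt_two
  have h1 : |Real.log (dyadicScale k)| = k * Real.log 2 := by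
    rw [dyadicScale, Real.log_inv, Real.log_pow, abs_neg, abs_of_nonneg (by positivity)]
  have h2 : 2 / Real.log 2 * |Real.log (dyadicScale k)| = 2 * k := by
    rw [h1]
    field_simp
  have h3 : 2 ^ Nat.clog 2 k ≤ 2 * k := by
    rcases hk.eq_or_lt with rfl | hk
    · simp
    · have h4 := Nat.pow_pred_clog_lt_self one_lt_two hk
      have h5 : Nat.clog 2 k = (Nat.clog 2 k).pred + 1 :=
        (Nat.succ_pred_eq_of_pos (Nat.clog_pos one_lt_two hk)).symm
      rw [h5, pow_succ]
      omega
  have h6 : ((2 : ℝ) ^ Nat.clog 2 k) ≤ 2 * k := by exact_mod_cast h3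
  have h7 : 0 ≤ Real.logb 2 A := Real.logb_nonneg one_lt_two hA
  rw [h2]
  calc A ^ Nat.clog 2 g ≤ A ^ Nat.clog 2 k := by
        gcongr
    _ = ((2 : ℝ) ^ Real.logb 2 A) ^ Nat.clog 2 k := by
        rw [Real.rpow_logb two_pos (by norm_num) (by linarith)]
    _ = ((2 : ℝ) ^ Nat.clog 2 k) ^ Real.logb 2 A := by
        rw [← Real.rpow_natCast, ← Real.rpow_natCast, ← Real.rpow_mul zero_le_two,
          ← Real.rpow_mul zero_le_two, mul_comm]
    _ ≤ _ := Real.rpow_le_rpow (by positivity) h6 h7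

end Iteration
end

/-! ### The main theorem. -/

theorem mainTheorem5 (m n : ℕ) (hn : 1 ≤ n) (hnd : n ≤ m + 1)
    (P : Fin n → QuadraticForm ℝ (Fin (m + 1) → ℝ)) (M : ℝ) :
    ∃ C₀ : ℝ, ∀ C : ℝ, C₀ ≤ C → ∀ A : ℝ,
      ∃ CS : ℝ, ∀ (p : ℝ≥0∞) [Fact (1 ≤ p)], p ≠ ∞ → ∀ Λ c : ℝ, 0 < c →
        ∃ K : ℝ, ∀ (v : EuclideanSpace ℝ (Fin m)) (b : ℝ), ‖v‖ ≤ M →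
          (graphHyperplane v b ∩ Set.Icc 0 1).Nonempty →
          (∀ k : ℕ, decouplingConst p C (restrictToHyperplane P v b) k
            ≤ A * dyadicScale k ^ (-Λ)) →
          ∀ k : ℕ, 1 ≤ k →
            DecouplingInequality p C (quadraticMap P) k (cubesNear c (graphHyperplane v b) k)
              (K * |Real.log (dyadicScale k)| ^ CS * dyadicScale k ^ (-Λ)) := by
  obtain ⟨C₀, K, hK0, hcol⟩ := exists_const_column_decoupling P M
  refine ⟨max C₀ 0, fun C hC A => ⟨Real.logb 2 (max A 1), fun p hp1 hp Λ c hc => ?_⟩⟩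
  have hC₀ : C₀ ≤ C := (le_max_left _ _).trans hC
  have hC0 : 0 ≤ C := (le_max_right _ _).trans hC
  set A' := max A 1
  have hA' : 1 ≤ A' := le_max_right _ _
  have hp0 : 0 < p.toReal :=
    ENNReal.toReal_pos (zero_lt_one.trans_le hp1.out).ne' hp
  -- The first summand is the width, in units of `δ`, of the neighbourhood of `H` containing the
  -- boxes; the second meets the lower bound on `R` in the column step.
  set R : ℝ := (1 + m * |M|) * (C + 1 + c) + (1 + C + K * C ^ 2) with hR
  obtain ⟨q, hq⟩ := pow_unbounded_of_one_lt R (one_lt_two : (1 : ℝ) < 2)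
  -- The iteration stops at gap at most `1` from `k - q`, hence `q + 1` dyadic steps above `δ`.
  obtain ⟨N, hN⟩ := exists_nat_ge (max (2 * R + m * |M| * 2 ^ (q + 1)) (2 ^ (q + 1)))
  set N' : ℝ := (((2 * N + 1) ^ (m + 1) : ℕ) : ℝ) with hN'
  have hN'0 : 0 ≤ N' := Nat.cast_nonneg _
  set CS := Real.logb 2 A' with hCS
  refine ⟨(2 / Real.log 2) ^ CS * (N' * 2 ^ |Λ|) * 2 ^ (q * |Λ|), ?_⟩
  intro v b hv _ hdec k hk f hf
  set S := cubesNear c (graphHyperplane v b) k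
  have hv' : ‖v‖ ≤ |M| := hv.trans (le_abs_self M)
  have hKC : 0 ≤ K * C ^ 2 := by positivity
  have hmM : 0 ≤ (m : ℝ) * |M| := by positivity
  have hδ := dyadicScale_pos k
  have hS : ∀ j ∈ S, ∀ t : Fin (m + 1) → ℝ,
      (∀ i, |t i - dyadicCorner j i| ≤ C * dyadicScale k) →
      |t (Fin.last m) - affineFun v b (Fin.init t)| ≤ R * dyadicScale k := by
    intro j hj t ht
    refine (abs_sub_affineFun_le_of_mem_cubesNear hc hv' hj ht).trans ?_
    gcongr
    linarith
  have hlog : 0 < Real.log 2 := Real.log_pos one_lt_two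
  have hcard : ∀ κ θ, k - q ≤ κ + 1 → ((columnOver S κ θ).card : ℝ) ≤ N' := by
    intro κ θ hκ
    rw [hN']
    exact_mod_cast card_columnOver_le (q := q + 1) hv' (by omega) S
      (fun j hj => hS j hj _ fun i => by simpa using by positivity)
      ((le_max_left _ _).trans hN) (by exact_mod_cast (le_max_right _ _).trans hN) θ
  have hiter := norm_sum_columnOver_le (k₀ := k - q) S f (p := p.toReal) (A := A')
    (B := N' * 2 ^ |Λ|) (Λ := Λ) hp0 hA' (by positivity) (Nat.sub_le _ _) ?_ ?_ (k - q) 0 0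
    (zero_add _)
  · have hcol0 : columnOver S 0 0 = S := by
      refine Finset.filter_true_of_mem fun j _ i => ?_
      exact Nat.div_eq_of_lt (j i.castSucc).2
    rw [hcol0] at hiter
    refine hiter.trans (mul_le_mul_of_nonneg_right ?_
      (Real.rpow_nonneg (Finset.sum_nonneg fun j _ => by positivity) _))
    have h1 := pow_clog_le hA' hk (Nat.sub_le k q)
    rw [Real.mul_rpow (by positivity) (abs_nonneg _), ← hCS] at h1
    have h2 : dyadicScale (k - q) ^ (-Λ) ≤ 2 ^ (q * |Λ|) * dyadicScale k ^ (-Λ) := by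
      have h3 : dyadicScale k = dyadicScale (k - q) * dyadicScale (k - (k - q)) := by
        rw [← dyadicScale_add]
        congr 1
        omega
      have h4 := dyadicScale_rpow_le (by omega : k - (k - q) ≤ q) Λ
      have h5 := dyadicScale_pos (k - (k - q))
      have h6 := dyadicScale_pos (k - q)
      calc dyadicScale (k - q) ^ (-Λ)
          = dyadicScale (k - (k - q)) ^ Λ * dyadicScale k ^ (-Λ) := by
            rw [h3, Real.mul_rpow h6.le h5.le, mul_left_comm, ← Real.rpow_add h5]
            simp
        _ ≤ _ := mul_le_mul_of_nonneg_right h4 (Real.rpow_nonneg hδ.le _)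
    calc _ ≤ ((2 / Real.log 2) ^ CS * |Real.log (dyadicScale k)| ^ CS) * (N' * 2 ^ |Λ|)
          * (2 ^ (q * |Λ|) * dyadicScale k ^ (-Λ)) := by
          gcongr
          exact Real.rpow_nonneg (dyadicScale_pos _).le _
      _ = _ := by ring
  · intro κ θ hκ
    refine (norm_sum_le_card_mul _ f hp0 (hcard κ θ hκ)).trans (mul_le_mul_of_nonneg_right ?_
      (Real.rpow_nonneg (Finset.sum_nonneg fun j _ => by positivity) _))
    have h1 := dyadicScale_rpow_le (by omega : k - q - κ ≤ 1) Λ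
    have h2 := dyadicScale_pos (k - q - κ)
    rw [Nat.cast_one, one_mul] at h1
    -- For `Λ < 0` the scale factor can be below `1`; the scale is `1` or `1/2`, so `2 ^ |Λ|`
    -- compensates.
    have h3 : 1 ≤ 2 ^ |Λ| * dyadicScale (k - q - κ) ^ (-Λ) := by
      rw [Real.rpow_neg h2.le, ← div_eq_mul_inv, one_le_div (Real.rpow_pos_of_pos h2 _)]
      exact h1
    rw [mul_assoc]
    exact le_mul_of_one_le_right hN'0 h3
  · intro κ μ θ hκ hμ
    have hpos : 0 ≤ dyadicScale μ ^ (-Λ) := Real.rpow_nonneg (dyadicScale_pos μ).le _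
    obtain ⟨-, h1⟩ := (decouplingConst_isLeast p hp C (restrictToHyperplane P v b) μ).1
    -- Here `μ ≥ 1` forces `k - q ≥ 2`, so the subtraction is not truncated; for `k ≤ q` the base
    -- case alone suffices.
    refine hcol C hC₀ hC0 v b hv p hp (by omega) hκ ?_ hq.le S hS _ (by positivity)
      (fun g hg => (h1 g hg).trans (mul_le_mul_of_nonneg_right
        ((hdec μ).trans (mul_le_mul_of_nonneg_right (le_max_left _ _) hpos))
        (Real.rpow_nonneg (Finset.sum_nonneg fun j _ => by positivity) _))) θ f hf
    have : 0 ≤ (1 + m * |M|) * (C + 1 + c) := by positivity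
    linarith
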